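/- Fix $p \ge 0$. For each $n$ consider an experiment on $n$ units, on its own probability space, with binary treatments $W_1,\dots,W_n$, feature vectors $X_1,\dots,X_n\in\mathbb R^p$ (intercept excluded), errors $\varepsilon_1,\dots,\varepsilon_n$ and responses $$Y_i = W_i(\alpha_1+\eta_1^\top X_i) + (1-W_i)(\alpha_0+\eta_0^\top X_i)+\varepsilon_i .$$ All quantities, including the coefficients $\alpha_w,\eta_w$, may depend on $n$. Write $\mathbf W=(W_1,\dots,W_n)$, $X=(X_1,\dots,X_n)$, and $\mathbf W_{-i}$ for $\mathbf W$ with $W_i$ removed. Assume for every $n$: 1. $W_1,\dots,W_n$ are i.i.d. Bernoulli$(\pi_n)$ with $0<\pi_n<1$, and $X_i$ is independent of $W_i$ for all $i$. 2. Conditionally on $(X,\mathbf W)$, the errors are independent, $E[\varepsilon_i\mid X,\mathbf W]=0$ and $\operatorname{Var}(\varepsilon_i\mid X,\mathbf W)=\sigma_n^2$. 3. Either each $X_i$ is a deterministic function of $\mathbf W_{-i}$, or else the array $(X_1,\dots,X_n)$ is independent of $\mathbf W$. 4. (Static features) $X_i$ is independent of $\mathbf W_{-i}$ for all $i$. Assume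 also that, as $n\to\infty$, $\pi_n\to\pi\in(0,1)$ and $\sigma_n^2\to\sigma^2\ge 0$; that $\bar X=\frac1n\sum_i X_i\to\mu_X$ and $\frac1n\sum_i (X_i-\bar X)(X_i-\bar X)^\top\to\Sigma_X$ in probability, where $\Sigma_X$ is positive definite; and that the fourth moments of all coordinates of the $X_i$ and of all $\varepsilon_i$ are bounded uniformly in $i$ and $n$. For $w\in\{0,1\}$ let $\omega_w=\frac1n\sum_i E[X_i\mid \mathbf W_{-i}=(w,\dots,w)]$. Let $$\tau=\frac1n\sum_i\bigl(E[Y_i\mid \mathbf W=(1,\dots,1)]-E[Y_i\mid \mathbf W=(0,\dots,0)]\bigr)$$ be the global average treatment effect. Let $\hat\beta_w\in\mathbb R^{p+1}$ be the vector of ordinary least squares coefficients in the regression of $Y_i$ on $(1,X_i)$ over the units with $W_i=w$ (defined arbitrarily, say as $0$, when the Gram matrix is singular), and let $\hat\tau=(1,\omega_1)^\top\hat\beta_1-(1,\omega_0)^\top\hat\beta_0$. Then $\omega_0=\omega_1=E[\bar X]$ for every $n$, both $\omega_0$ and $\omega_1$ converge to $\mu_X$ as $n\to\infty$, and $$\sqrt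 n\,(\hat\tau-\tau)\ \Rightarrow\ N\!\left(0,\frac{\sigma^2}{\pi(1-\pi)}\right).$$ -/

import Mathlib

open MeasureTheory ProbabilityTheory Filter Topology
open scoped Matrix NNReal ENNReal

noncomputable section

/-- The random variables and coefficients of one experiment on `n` units with `p` features
(intercept excluded), over a sample space `Ω`. The treatment arms are labelled by `Bool`
(`true` is treatment, `false` is control). -/
structure Experiment (n p : ℕ) (Ω : Type*) [MeasurableSpace Ω] where
  /-- treatment assignments -/
  W : Fin n → Ω → Bool
  /-- feature vectors -/
  X : Fin n → Ω → Fin p → ℝ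
  /-- residuals -/
  ε : Fin n → Ω → ℝ
  /-- intercept of each arm -/
  α : Bool → ℝ
  /-- slope vector of each arm -/
  η : Bool → Fin p → ℝ
  measurable_W : ∀ i, Measurable (W i)
  measurable_X : ∀ i, Measurable (X i)
  measurable_ε : ∀ i, Measurable (ε i)

namespace Experiment

variable {n p : ℕ} {Ω : Type*} [MeasurableSpace Ω]

/-- The whole treatment vector. -/
def treatments (D : Experiment n p Ω) (ω : Ω) : Fin n → Bool := fun i => D.W i ω

/-- The indirect treatments of unit `i`: all treatments except its own. -/
def indirect (D : Experiment n p Ω) (i : Fin n) (ω : Ω) : {j : Fin n // j ≠ i} → Bool :=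
  fun j => D.W j ω

/-- The whole array of features. -/
def features (D : Experiment n p Ω) (ω : Ω) : Fin n → Fin p → ℝ := fun i => D.X i ω

/-- The vector of residuals. -/
def errors (D : Experiment n p Ω) (ω : Ω) : Fin n → ℝ := fun i => D.ε i ω

/-- All features together with all treatments, on which the error assumptions condition. -/
def design (D : Experiment n p Ω) (ω : Ω) : (Fin n → Fin p → ℝ) × (Fin n → Bool) :=
  (D.features ω, D.treatments ω)

/-- The sigma-algebra generated by all features and all treatments. -/
abbrev designSigma (D : Experiment n p Ω) : MeasurableSpace Ω :=
  MeasurableSpace.comap D.design inferInstance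

/-- The linear response surface `α_w + η_w ⬝ x` of arm `w`. -/
def surface (D : Experiment n p Ω) (w : Bool) (x : Fin p → ℝ) : ℝ := D.α w + D.η w ⬝ᵥ x

/-- The observed response of unit `i` (separate-slopes linear model). -/
def Y (D : Experiment n p Ω) (i : Fin n) (ω : Ω) : ℝ :=
  D.surface (D.W i ω) (D.X i ω) + D.ε i ω

/-- The sample mean of the features. -/
def xbar (D : Experiment n p Ω) (ω : Ω) : Fin p → ℝ :=
  fun k => (1 / (n : ℝ)) * ∑ i, D.X i ω k

/-- The sample covariance matrix of the features. -/
def sampleCov (D : Experiment n p Ω) (ω : Ω) : Matrix (Fin p) (Fin p) ℝ :=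
  Matrix.of fun k l =>
    (1 / (n : ℝ)) * ∑ i, (D.X i ω k - D.xbar ω k) * (D.X i ω l - D.xbar ω l)

/-- The mean counterfactual features when everybody is assigned to arm `w`: the average over the
units `i` of `E[X_i | W_{-i} = (w, …, w)]`. When `X_i = x_i(W_{-i})` the `i`-th conditional
expectation is `x_i(w, …, w)`. -/
def omega (D : Experiment n p Ω) (P : Measure Ω) (w : Bool) : Fin p → ℝ :=
  fun k => (1 / (n : ℝ)) * ∑ i, ∫ ω, D.X i ω k ∂(P[|{ω | ∀ j, D.indirect i ω j = w}])

/-- The global average treatment effect: the average over the units of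
`E[Y_i | W = 1] - E[Y_i | W = 0]`. -/
def gate (D : Experiment n p Ω) (P : Measure Ω) : ℝ :=
  (1 / (n : ℝ)) * ∑ i, (∫ ω, D.Y i ω ∂(P[|{ω | ∀ j, D.W j ω = true}])
    - ∫ ω, D.Y i ω ∂(P[|{ω | ∀ j, D.W j ω = false}]))

/-- The design matrix of arm `w`: one row `(1, X_i)` for each unit assigned to arm `w`. -/
def armMatrix (D : Experiment n p Ω) (w : Bool) (ω : Ω) :
    Matrix {i : Fin n // D.W i ω = w} (Fin (p + 1)) ℝ :=
  Matrix.of fun i => Matrix.vecCons 1 (D.X i ω)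

/-- The responses observed in arm `w`. -/
def armResponse (D : Experiment n p Ω) (w : Bool) (ω : Ω) : {i : Fin n // D.W i ω = w} → ℝ :=
  fun i => D.Y i ω

/-- The OLS coefficients (intercept first) of arm `w`. -/
def betaHat (D : Experiment n p Ω) (w : Bool) (ω : Ω) : Fin (p + 1) → ℝ :=
  ((D.armMatrix w ω)ᵀ * D.armMatrix w ω)⁻¹ *ᵥ ((D.armMatrix w ω)ᵀ *ᵥ D.armResponse w ω)

/-- The regression-adjusted estimator of the global average treatment effect. -/
def tauHat (D : Experiment n p Ω) (P : Measure Ω) (ω : Ω) : ℝ :=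
  Matrix.vecCons 1 (D.omega P true) ⬝ᵥ D.betaHat true ω
    - Matrix.vecCons 1 (D.omega P false) ⬝ᵥ D.betaHat false ω

/-- The standing assumptions on one experiment: Bernoulli design with treatment probability `q`,
every feature independent of the unit's own treatment, and errors that, given all features and all
treatments, have mean zero, variance `σ ^ 2`, and are independent. -/
structure Regular (D : Experiment n p Ω) (P : Measure Ω) [IsProbabilityMeasure P] (q σ : ℝ) :
    Prop where
  prob_pos : 0 < q
  prob_lt_one : q < 1
  treatments_indep : iIndepFun D.W P
  treatments_law : ∀ i, P {ω | D.W i ω = true} = ENNReal.ofReal q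
  feature_indep_own : ∀ i, IndepFun (D.X i) (D.W i) P
  errors_memLp : ∀ i, MemLp (D.ε i) 2 P
  errors_exogenous : ∀ i, P[D.ε i | D.designSigma] =ᵐ[P] fun _ => 0
  errors_homoscedastic : ∀ i, condVar D.designSigma (D.ε i) P =ᵐ[P] fun _ => σ ^ 2
  /-- Under the regular conditional law of the error vector given the design, the coordinates are
  independent. -/
  errors_indep : ∀ᵐ z ∂(P.map D.design),
    iIndepFun (fun (i : Fin n) (e : Fin n → ℝ) => e i) (condDistrib D.errors D.design P z)

/-- Every feature vector is (almost surely) a deterministic function of the indirect treatments. -/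
def FeaturesOfIndirect (D : Experiment n p Ω) (P : Measure Ω) : Prop :=
  ∀ i, ∃ x : ({j : Fin n // j ≠ i} → Bool) → Fin p → ℝ, D.X i =ᵐ[P] fun ω => x (D.indirect i ω)

/-- All fourth moments of feature coordinates and of errors are at most `C`. -/
def FourthMomentsLE (D : Experiment n p Ω) (P : Measure Ω) (C : ℝ≥0) : Prop :=
  ∀ i, (∀ k, ∫⁻ ω, ‖D.X i ω k‖ₑ ^ 4 ∂P ≤ C) ∧ ∫⁻ ω, ‖D.ε i ω‖ₑ ^ 4 ∂P ≤ C

end Experiment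

/-- Convergence in probability to the constant `c` of random variables that may live on different
probability spaces. -/
def TendstoInProb {Ω : ℕ → Type*} [∀ n, MeasurableSpace (Ω n)] (P : ∀ n, Measure (Ω n))
    (Z : ∀ n, Ω n → ℝ) (c : ℝ) : Prop :=
  ∀ δ : ℝ, 0 < δ → Tendsto (fun n => P n {ω | δ ≤ |Z n ω - c|}) atTop (𝓝 0)

end

/-!
A static feature vector that is a function of the indirect treatments is almost surely constant, so
under either alternative the features are independent of the treatment vector. Hence both `ω_w` are
equal to `E[X̄]`, and the average treatment effect is the difference of the two true regression
surfaces at that point.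

Divided by `n`, the Gram matrix of an arm converges in probability to the probability of the arm
times the second moment matrix of `(1, X)`. The inverse of that matrix maps `(1, μ_X)` to the first
unit vector, so the fitted surface at `E[X̄]` has the same limiting error as a plain average, and
`√n (τ̂ - τ)` is asymptotically `n^{-1/2} ∑ ± ε_i / P(W_i)`. Given the design this is a sum of
independent errors with bounded weights. Comparing its conditional characteristic function factor
by factor with that of a Gaussian gives the limit, with variance
`σ² (1 / π + 1 / (1 - π)) = σ² / (π (1 - π))`.
-/

section WithHighProbability

variable {Ω : ℕ → Type*} [∀ n, MeasurableSpace (Ω n)]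

/-- The filter on the disjoint union of a sequence of probability spaces formed by the events whose
probability tends to one. Convergence in probability, even on varying spaces, is `Tendsto` along
this filter, so that the continuous mapping theorem for it is composition of limits. -/
def whp (P : ∀ n, Measure (Ω n)) : Filter (Σ n, Ω n) where
  sets := {S | Tendsto (fun n => P n {ω | (⟨n, ω⟩ : Σ n, Ω n) ∉ S}) atTop (𝓝 0)}
  univ_sets := by simp
  sets_of_superset hS hST :=
    tendsto_of_tendsto_of_tendsto_of_le_of_le tendsto_const_nhds hS (fun _ => zero_le)
      fun _ => measure_mono fun _ hω h => hω (hST h)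
  inter_sets {S T} hS hT := by
    refine tendsto_of_tendsto_of_tendsto_of_le_of_le tendsto_const_nhds
      (by simpa using Tendsto.add hS hT) (fun _ => zero_le)
      fun n => (measure_mono fun ω hω => ?_).trans (measure_union_le _ _)
    exact not_and_or.1 hω

variable {P : ∀ n, Measure (Ω n)}

lemma eventually_whp {p : (Σ n, Ω n) → Prop} :
    (∀ᶠ x in whp P, p x) ↔ Tendsto (fun n => P n {ω | ¬ p ⟨n, ω⟩}) atTop (𝓝 0) := Iff.rfl

lemma tendsto_fst_whp : Tendsto (fun x : Σ n, Ω n => x.1) (whp P) atTop := by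
  refine tendsto_atTop.2 fun N => eventually_whp.2 <| tendsto_const_nhds.congr' ?_
  filter_upwards [eventually_ge_atTop N] with n hn
  simp [hn]

lemma TendstoInProb.tendsto_whp {Z : ∀ n, Ω n → ℝ} {c : ℝ} (h : TendstoInProb P Z c) :
    Tendsto (fun x : Σ n, Ω n => Z x.1 x.2) (whp P) (𝓝 c) := by
  refine Metric.tendsto_nhds.2 fun δ hδ => eventually_whp.2 ?_
  simpa [Real.dist_eq] using h δ hδ

section Normed

variable {E : Type*} [NormedAddCommGroup E]

lemma tendsto_whp_iff {Z : (Σ n, Ω n) → E} {c : E} :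
    Tendsto Z (whp P) (𝓝 c) ↔
      ∀ δ : ℝ≥0∞, 0 < δ → Tendsto (fun n => P n {ω | δ ≤ ‖Z ⟨n, ω⟩ - c‖ₑ}) atTop (𝓝 0) := by
  simp_rw [EMetric.tendsto_nhds, eventually_whp, not_lt, edist_eq_enorm_sub]

lemma exists_measure_enorm_ge_le_of_eLpNorm_le {Z : ∀ n, Ω n → E} {r M e : ℝ≥0∞} (hr : r ≠ 0)
    (hr' : r ≠ ∞) (hm : ∀ n, AEStronglyMeasurable (Z n) (P n))
    (hZ : ∀ n, eLpNorm (Z n) r (P n) ≤ M) (hM : M ≠ ∞) (he : 0 < e) :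
    ∃ R : ℝ≥0∞, R ≠ ∞ ∧ ∀ n, P n {ω | R ≤ ‖Z n ω‖ₑ} ≤ e := by
  have hlim : Tendsto (fun N : ℕ => (N : ℝ≥0∞)⁻¹ ^ r.toReal * M ^ r.toReal) atTop (𝓝 0) := by
    simpa [ENNReal.toReal_pos hr hr'] using ENNReal.Tendsto.mul_const
      (ENNReal.tendsto_inv_nat_nhds_zero.ennrpow_const r.toReal) (Or.inr (by finiteness))
  obtain ⟨N, hN, hN0⟩ :=
    ((ENNReal.tendsto_nhds_zero.1 hlim e he).and (eventually_gt_atTop 0)).exists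
  refine ⟨N, ENNReal.natCast_ne_top N, fun n => ?_⟩
  calc P n {ω | (N : ℝ≥0∞) ≤ ‖Z n ω‖ₑ}
      ≤ (N : ℝ≥0∞)⁻¹ ^ r.toReal * eLpNorm (Z n) r (P n) ^ r.toReal :=
        meas_ge_le_mul_pow_eLpNorm_enorm (P n) hr hr' (hm n) (by simpa using hN0.ne') (by simp)
    _ ≤ (N : ℝ≥0∞)⁻¹ ^ r.toReal * M ^ r.toReal := by gcongr; exact hZ n
    _ ≤ e := hN

lemma tendsto_whp_zero_mul_of_eLpNorm_le {A : (Σ n, Ω n) → ℝ} {Z : ∀ n, Ω n → ℝ} {r M : ℝ≥0∞}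
    (hA : Tendsto A (whp P) (𝓝 0)) (hr : r ≠ 0) (hr' : r ≠ ∞)
    (hm : ∀ n, AEStronglyMeasurable (Z n) (P n)) (hZ : ∀ n, eLpNorm (Z n) r (P n) ≤ M)
    (hM : M ≠ ∞) :
    Tendsto (fun x : Σ n, Ω n => A x * Z x.1 x.2) (whp P) (𝓝 0) := by
  refine tendsto_whp_iff.2 fun δ hδ => ENNReal.tendsto_nhds_zero.2 fun e he => ?_
  obtain ⟨R, hR, hZR⟩ := exists_measure_enorm_ge_le_of_eLpNorm_le hr hr' hm hZ hM
    (ENNReal.half_pos he.ne')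
  have hAR := tendsto_whp_iff.1 hA (δ / R) (ENNReal.div_pos hδ.ne' hR)
  filter_upwards [ENNReal.tendsto_nhds_zero.1 hAR (e / 2) (ENNReal.half_pos he.ne')] with n hn
  have hsub : {ω | δ ≤ ‖A ⟨n, ω⟩ * Z n ω - 0‖ₑ} ⊆
      {ω | δ / R ≤ ‖A ⟨n, ω⟩ - 0‖ₑ} ∪ {ω | R ≤ ‖Z n ω‖ₑ} := by
    intro ω hω
    by_contra! hcon
    simp only [Set.mem_union, Set.mem_ofPred_eq, sub_zero, not_or, not_le] at hcon hω
    refine hω.not_gt ?_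
    rw [enorm_mul]
    exact (mul_le_mul_right hcon.2.le _).trans_lt (ENNReal.mul_lt_of_lt_div hcon.1)
  calc P n {ω | δ ≤ ‖A ⟨n, ω⟩ * Z n ω - 0‖ₑ}
      ≤ P n {ω | δ / R ≤ ‖A ⟨n, ω⟩ - 0‖ₑ} + P n {ω | R ≤ ‖Z n ω‖ₑ} :=
        (measure_mono hsub).trans (measure_union_le _ _)
    _ ≤ e / 2 + e / 2 := add_le_add hn (hZR n)
    _ = e := ENNReal.add_halves e

lemma eLpNorm_one_le_add_mul_rpow_measure {α : Type*} [MeasurableSpace α] {μ : Measure α}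
    [IsProbabilityMeasure μ] {f : α → E} (hf : AEStronglyMeasurable f μ) (δ : ℝ≥0∞) :
    eLpNorm f 1 μ ≤ δ + eLpNorm f 2 μ * μ {a | δ ≤ ‖f a‖ₑ} ^ (1 / 2 : ℝ) := by
  set S := {a | δ ≤ ‖f a‖ₑ}
  have hpt : ∀ a, ‖f a‖ₑ ≤ δ + S.indicator (fun a => ‖f a‖ₑ) a := fun a => by
    by_cases ha : a ∈ S
    · simp [ha]
    · simpa [ha] using (not_le.1 ha).le
  have hHolder : eLpNorm f 1 (μ.restrict S) ≤ eLpNorm f 2 (μ.restrict S) * μ S ^ (1 / 2 : ℝ) := by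
    have h := eLpNorm_le_eLpNorm_mul_rpow_measure_univ (p := 1) (q := 2) one_le_two hf.restrict
      (μ := μ.restrict S)
    norm_num only [ENNReal.toReal_one, ENNReal.toReal_ofNat, Measure.restrict_apply_univ] at h
    exact h
  calc eLpNorm f 1 μ ≤ ∫⁻ a, (δ + S.indicator (fun a => ‖f a‖ₑ) a) ∂μ := by
        rw [eLpNorm_one_eq_lintegral_enorm]
        exact lintegral_mono hpt
    _ ≤ δ + eLpNorm f 1 (μ.restrict S) := by
        rw [lintegral_add_left measurable_const, lintegral_const, measure_univ, mul_one,
          eLpNorm_one_eq_lintegral_enorm]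
        exact add_le_add_right (lintegral_indicator_le _ _) _
    _ ≤ δ + eLpNorm f 2 μ * μ S ^ (1 / 2 : ℝ) := by
        gcongr
        exact hHolder.trans (by gcongr; exact Measure.restrict_le_self)

lemma tendsto_integral_of_tendsto_whp [NormedSpace ℝ E] [CompleteSpace E]
    [∀ n, IsProbabilityMeasure (P n)] {Z : ∀ n, Ω n → E} {c : E} {M : ℝ≥0∞}
    (hc : Tendsto (fun x : Σ n, Ω n => Z x.1 x.2) (whp P) (𝓝 c))
    (hm : ∀ n, AEStronglyMeasurable (Z n) (P n)) (hZ : ∀ n, eLpNorm (Z n) 2 (P n) ≤ M)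
    (hM : M ≠ ∞) :
    Tendsto (fun n => ∫ ω, Z n ω ∂(P n)) atTop (𝓝 c) := by
  have hL2 : ∀ n, MemLp (Z n) 2 (P n) := fun n => ⟨hm n, (hZ n).trans_lt hM.lt_top⟩
  have hdiff : ∀ n, MemLp (fun ω => Z n ω - c) 2 (P n) := fun n => (hL2 n).sub (memLp_const c)
  have hbound : ∀ n, eLpNorm (fun ω => Z n ω - c) 2 (P n) ≤ M + ‖c‖ₑ := fun n => by
    refine (eLpNorm_sub_le (hm n) aestronglyMeasurable_const one_le_two).trans ?_
    gcongr
    · exact hZ n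
    · simp [eLpNorm_const' c two_ne_zero ENNReal.ofNat_ne_top]
  refine EMetric.tendsto_nhds.2 fun e he => ?_
  obtain ⟨δ, hδ, hδe⟩ := exists_between he
  have hprob : Tendsto (fun n => δ + (M + ‖c‖ₑ) *
      P n {ω | δ ≤ ‖Z n ω - c‖ₑ} ^ (1 / 2 : ℝ)) atTop (𝓝 δ) := by
    have h := ENNReal.Tendsto.const_mul (a := M + ‖c‖ₑ)
      ((tendsto_whp_iff.1 hc δ hδ).ennrpow_const (1 / 2)) (Or.inr (by finiteness))
    simpa using h.const_add δ
  filter_upwards [hprob.eventually_lt_const hδe] with n hn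
  refine lt_of_le_of_lt ?_ hn
  calc edist (∫ ω, Z n ω ∂(P n)) c = ‖∫ ω, (Z n ω - c) ∂(P n)‖ₑ := by
        rw [edist_eq_enorm_sub, integral_sub ((hL2 n).integrable one_le_two) (integrable_const c)]
        simp
    _ ≤ eLpNorm (fun ω => Z n ω - c) 1 (P n) := by
        rw [eLpNorm_one_eq_lintegral_enorm]
        exact enorm_integral_le_lintegral_enorm _
    _ ≤ _ := (eLpNorm_one_le_add_mul_rpow_measure (hdiff n).1 δ).trans (by gcongr; exact hbound n)

end Normed

end WithHighProbability

section Moments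

variable {α : Type*} [MeasurableSpace α] {μ : Measure α}

lemma eLpNorm_two_sq_eq_ofReal_integral_sq {f : α → ℝ} (hf : MemLp f 2 μ) :
    eLpNorm f 2 μ ^ 2 = ENNReal.ofReal (∫ a, f a ^ 2 ∂μ) := by
  rw [ofReal_integral_eq_lintegral_ofReal hf.integrable_sq (ae_of_all _ fun a => sq_nonneg (f a))]
  have h := eLpNorm_nnreal_pow_eq_lintegral (f := f) (p := 2) (μ := μ) two_ne_zero
  simpa [← ENNReal.ofReal_pow, Real.enorm_eq_ofReal_abs] using h

lemma eLpNorm_natCast_le_of_lintegral_pow_le {E : Type*} [NormedAddCommGroup E] {f : α → E} {m : ℕ}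
    (hm : m ≠ 0) {K : ℝ≥0∞} (h : ∫⁻ a, ‖f a‖ₑ ^ m ∂μ ≤ K) : eLpNorm f m μ ≤ max 1 K := by
  rcases le_total (eLpNorm f m μ) 1 with h1 | h1
  · exact le_max_of_le_left h1
  · have hpow : eLpNorm f m μ ^ m = ∫⁻ a, ‖f a‖ₑ ^ m ∂μ := by
      simpa using eLpNorm_nnreal_pow_eq_lintegral (f := f) (p := m) (μ := μ) (by simpa using hm)
    exact le_max_of_le_right ((le_self_pow₀ h1 hm).trans (hpow.trans_le h))

lemma eLpNorm_two_mul_le {f g : α → ℝ} (hf : AEStronglyMeasurable f μ)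
    (hg : AEStronglyMeasurable g μ) :
    eLpNorm (fun a => f a * g a) 2 μ ≤ eLpNorm f 4 μ * eLpNorm g 4 μ := by
  have hquarter : (4 : ℝ≥0∞)⁻¹ = 2⁻¹ * 2⁻¹ := by
    rw [← ENNReal.mul_inv (by simp) (by simp)]
    norm_num
  have : ENNReal.HolderTriple 4 4 2 :=
    ⟨by rw [hquarter, ← mul_add, ENNReal.inv_two_add_inv_two, mul_one]⟩
  have hHolder : eLpNorm (f • g) 2 μ ≤ eLpNorm f 4 μ * eLpNorm g 4 μ :=
    eLpNorm_smul_le_mul_eLpNorm hg hf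
  exact hHolder

lemma eLpNorm_average_le {n : ℕ} {f : Fin n → α → ℝ} {r M : ℝ≥0∞} (hr : 1 ≤ r)
    (hm : ∀ i, AEStronglyMeasurable (f i) μ) (hM : ∀ i, eLpNorm (f i) r μ ≤ M) :
    eLpNorm (fun a => (1 / (n : ℝ)) * ∑ i, f i a) r μ ≤ M := by
  rcases n.eq_zero_or_pos with rfl | hn
  · simp
  have hsum : eLpNorm (∑ i, f i) r μ ≤ n * M :=
    (eLpNorm_sum_le (fun i _ => hm i) hr).trans
      ((Finset.sum_le_sum fun i _ => hM i).trans (by simp))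
  calc eLpNorm (fun a => (1 / (n : ℝ)) * ∑ i, f i a) r μ
      = ‖1 / (n : ℝ)‖ₑ * eLpNorm (∑ i, f i) r μ := by
        rw [← eLpNorm_const_smul]
        congr 1 with a
        simp
    _ ≤ (n : ℝ≥0∞)⁻¹ * (n * M) := by
        gcongr
        simp [Real.enorm_eq_ofReal, ENNReal.ofReal_inv_of_pos, hn]
    _ = M := by
        rw [← mul_assoc, ENNReal.inv_mul_cancel (by simpa using hn.ne') (by simp), one_mul]

section Orthogonal

variable {ι : Type*} [Fintype ι] {f : ι → α → ℝ}

lemma integral_sq_sum_of_orthogonal (hf : ∀ i, MemLp (f i) 2 μ)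
    (horth : ∀ i j, i ≠ j → ∫ a, f i a * f j a ∂μ = 0) :
    ∫ a, (∑ i, f i a) ^ 2 ∂μ = ∑ i, ∫ a, f i a ^ 2 ∂μ := by
  have hInt : ∀ i j, Integrable (fun a => f i a * f j a) μ := fun i j =>
    (hf i).integrable_mul (hf j)
  calc ∫ a, (∑ i, f i a) ^ 2 ∂μ = ∑ i, ∑ j, ∫ a, f i a * f j a ∂μ := by
        simp_rw [sq, Finset.sum_mul_sum]
        rw [integral_finsetSum _ fun i _ => integrable_finsetSum _ fun j _ => hInt i j]
        exact Finset.sum_congr rfl fun i _ => integral_finsetSum _ fun j _ => hInt i j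
    _ = ∑ i, ∫ a, f i a ^ 2 ∂μ := by
        refine Finset.sum_congr rfl fun i _ => ?_
        rw [Finset.sum_eq_single i (fun j _ hj => horth i j hj.symm) (by simp)]
        simp_rw [sq]

lemma eLpNorm_inv_sqrt_mul_sum_le_of_orthogonal {M : ℝ≥0∞} (hf : ∀ i, MemLp (f i) 2 μ)
    (horth : ∀ i j, i ≠ j → ∫ a, f i a * f j a ∂μ = 0) (hM : ∀ i, eLpNorm (f i) 2 μ ≤ M) :
    eLpNorm (fun a => (√(Fintype.card ι : ℝ))⁻¹ * ∑ i, f i a) 2 μ ≤ M := by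
  rcases isEmpty_or_nonempty ι with _ | _
  · simp
  have hcard : (0 : ℝ) < Fintype.card ι := by exact_mod_cast Fintype.card_pos
  have hsum : MemLp (fun a => (√(Fintype.card ι : ℝ))⁻¹ * ∑ i, f i a) 2 μ :=
    (memLp_finsetSum _ fun i _ => hf i).const_mul _
  refine (ENNReal.pow_le_pow_left_iff two_ne_zero).1 ?_
  calc eLpNorm (fun a => (√(Fintype.card ι : ℝ))⁻¹ * ∑ i, f i a) 2 μ ^ 2
      = ENNReal.ofReal ((Fintype.card ι : ℝ)⁻¹ * ∑ i, ∫ a, f i a ^ 2 ∂μ) := by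
        rw [eLpNorm_two_sq_eq_ofReal_integral_sq hsum]
        simp_rw [mul_pow, inv_pow, Real.sq_sqrt hcard.le]
        rw [integral_const_mul, integral_sq_sum_of_orthogonal hf horth]
    _ = (Fintype.card ι : ℝ≥0∞)⁻¹ * ∑ i, eLpNorm (f i) 2 μ ^ 2 := by
        simp_rw [eLpNorm_two_sq_eq_ofReal_integral_sq (hf _)]
        rw [ENNReal.ofReal_mul (by positivity), ENNReal.ofReal_inv_of_pos hcard,
          ENNReal.ofReal_natCast, ENNReal.ofReal_sum_of_nonneg fun i _ => integral_nonneg fun a =>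
            sq_nonneg (f i a)]
    _ ≤ (Fintype.card ι : ℝ≥0∞)⁻¹ * ∑ _i : ι, M ^ 2 := by gcongr; exact hM _
    _ = M ^ 2 := by
        rw [Finset.sum_const, Finset.card_univ, nsmul_eq_mul, ← mul_assoc,
          ENNReal.inv_mul_cancel (by simp) (by simp), one_mul]

end Orthogonal

end Moments

lemma integral_mul_eq_zero_of_condExp_eq_zero {α : Type*} {m m₀ : MeasurableSpace α}
    {μ : Measure α} (hm : m ≤ m₀) [SigmaFinite (μ.trim hm)] {c f : α → ℝ}
    (hc : StronglyMeasurable[m] c) (hf : Integrable f μ) (hcf : Integrable (c * f) μ)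
    (h : μ[f | m] =ᵐ[μ] 0) : ∫ a, c a * f a ∂μ = 0 := by
  have hpull : μ[c * f | m] =ᵐ[μ] 0 := by
    filter_upwards [condExp_mul_of_stronglyMeasurable_left hc hcf hf, h] with a h1 h2
    simp [h1, h2]
  calc ∫ a, c a * f a ∂μ = ∫ a, (μ[c * f | m]) a ∂μ := (integral_condExp hm).symm
    _ = 0 := by simp [integral_congr_ae hpull]

section LawOfLargeNumbers

variable {Ω : ℕ → Type*} [∀ n, MeasurableSpace (Ω n)] {P : ∀ n, Measure (Ω n)}

lemma tendsto_whp_average_of_orthogonal {f : ∀ n, Fin n → Ω n → ℝ} {M : ℝ≥0∞} (hM : M ≠ ∞)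
    (hf : ∀ n i, AEStronglyMeasurable (f n i) (P n)) (hfM : ∀ n i, eLpNorm (f n i) 2 (P n) ≤ M)
    (horth : ∀ n i j, i ≠ j → ∫ ω, f n i ω * f n j ω ∂(P n) = 0) :
    Tendsto (fun x : Σ n, Ω n => (1 / (x.1 : ℝ)) * ∑ i, f x.1 i x.2) (whp P) (𝓝 0) := by
  have hsqrt : Tendsto (fun x : Σ n, Ω n => (√(x.1 : ℝ))⁻¹) (whp P) (𝓝 0) :=
    (tendsto_inv_atTop_zero.comp
      (Real.tendsto_sqrt_atTop.comp tendsto_natCast_atTop_atTop)).comp tendsto_fst_whp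
  have hbound : ∀ n : ℕ, eLpNorm (fun ω => (√(n : ℝ))⁻¹ * ∑ i, f n i ω) 2 (P n) ≤ M := fun n => by
    simpa using eLpNorm_inv_sqrt_mul_sum_le_of_orthogonal
      (fun i => ⟨hf n i, (hfM n i).trans_lt hM.lt_top⟩) (horth n) (hfM n)
  refine (tendsto_whp_zero_mul_of_eLpNorm_le hsqrt two_ne_zero ENNReal.ofNat_ne_top
    (fun n => ((Finset.aestronglyMeasurable_fun_sum _ fun i _ => hf n i).const_mul _)) hbound
    hM).congr fun x => ?_
  rw [← mul_assoc, ← mul_inv, Real.mul_self_sqrt x.1.cast_nonneg, one_div]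

end LawOfLargeNumbers

section CharacteristicFunctions

lemma norm_prod_sub_prod_le_sum {ι : Type*} (s : Finset ι) (f g : ι → ℂ)
    (hf : ∀ i ∈ s, ‖f i‖ ≤ 1) (hg : ∀ i ∈ s, ‖g i‖ ≤ 1) :
    ‖∏ i ∈ s, f i - ∏ i ∈ s, g i‖ ≤ ∑ i ∈ s, ‖f i - g i‖ := by
  classical
  induction s using Finset.induction_on with
  | empty => simp
  | insert a s ha ih =>
    simp only [Finset.forall_mem_insert] at hf hg
    have hprod : ‖∏ i ∈ s, f i‖ ≤ 1 := by
      rw [norm_prod]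
      exact Finset.prod_le_one (fun _ _ => norm_nonneg _) hf.2
    rw [Finset.prod_insert ha, Finset.prod_insert ha, Finset.sum_insert ha]
    calc ‖f a * ∏ i ∈ s, f i - g a * ∏ i ∈ s, g i‖
        = ‖(f a - g a) * ∏ i ∈ s, f i + g a * (∏ i ∈ s, f i - ∏ i ∈ s, g i)‖ := by
          congr 1; ring
      _ ≤ ‖f a - g a‖ * ‖∏ i ∈ s, f i‖ + ‖g a‖ * ‖∏ i ∈ s, f i - ∏ i ∈ s, g i‖ := by
          rw [← norm_mul, ← norm_mul]
          exact norm_add_le _ _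
      _ ≤ ‖f a - g a‖ * 1 + 1 * ∑ i ∈ s, ‖f i - g i‖ := by
          gcongr
          exacts [hg.1, ih hf.2 hg.2]
      _ = ‖f a - g a‖ + ∑ i ∈ s, ‖f i - g i‖ := by ring

lemma norm_exp_ofReal_mul_I_sub_taylor_le (x : ℝ) :
    ‖Complex.exp (x * Complex.I) - (1 + x * Complex.I - (x ^ 2 / 2 : ℝ))‖ ≤ 4 * |x| ^ 3 := by
  have hnorm : ‖(x : ℂ) * Complex.I‖ = |x| := by simp
  rcases le_or_gt |x| 1 with hx | hx
  · have hsum : ∑ m ∈ Finset.range 3, ((x : ℂ) * Complex.I) ^ m / (m.factorial : ℂ) =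
        1 + x * Complex.I - (x ^ 2 / 2 : ℝ) := by
      simp only [Finset.sum_range_succ, Finset.range_zero, Finset.sum_empty, pow_zero,
        Nat.factorial, mul_pow, Complex.I_sq]
      push_cast
      ring
    have hexp := Complex.exp_bound (hnorm.trans_le hx) (n := 3) (by norm_num)
    rw [hnorm, hsum] at hexp
    refine hexp.trans ?_
    rw [mul_comm]
    gcongr
    norm_num [Nat.factorial]
  · have htaylor : ‖1 + x * Complex.I - (x ^ 2 / 2 : ℝ)‖ ≤ 1 + |x| + |x| ^ 2 / 2 := by
      refine (norm_sub_le _ _).trans (add_le_add ((norm_add_le _ _).trans ?_) ?_)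
      · rw [hnorm, norm_one]
      · rw [Complex.norm_real, Real.norm_of_nonneg (by positivity), sq_abs]
    have hsq : 1 ≤ |x| ^ 2 := one_le_pow₀ hx.le
    calc _ ≤ ‖Complex.exp (x * Complex.I)‖ + ‖1 + x * Complex.I - (x ^ 2 / 2 : ℝ)‖ :=
          norm_sub_le _ _
      _ ≤ 1 + (1 + |x| + |x| ^ 2 / 2) := by
          rw [Complex.norm_exp_ofReal_mul_I]
          gcongr
      _ ≤ 4 * |x| ^ 3 := by nlinarith [mul_le_mul_of_nonneg_left hsq (abs_nonneg x)]

lemma abs_exp_neg_half_sq_sub_le (x : ℝ) :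
    |Real.exp (-(x ^ 2 / 2)) - (1 - x ^ 2 / 2)| ≤ |x| ^ 3 := by
  have hlower : 1 - x ^ 2 / 2 ≤ Real.exp (-(x ^ 2 / 2)) := by
    linarith [Real.add_one_le_exp (-(x ^ 2 / 2))]
  rw [abs_of_nonneg (sub_nonneg.2 hlower)]
  rcases le_or_gt |x| 1 with hx | hx
  · have hexp := Real.norm_exp_sub_one_sub_id_le (x := -(x ^ 2 / 2)) (by
      rw [norm_neg, Real.norm_of_nonneg (by positivity), ← sq_abs]
      nlinarith [abs_nonneg x])
    rw [Real.norm_eq_abs, Real.norm_eq_abs, sq_abs] at hexp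
    have hpow : |x| ^ 4 ≤ |x| ^ 3 := pow_le_pow_of_le_one (abs_nonneg x) hx (by norm_num)
    have habs : |x| ^ 4 = x ^ 4 := Even.pow_abs (by decide) x
    nlinarith [le_abs_self (Real.exp (-(x ^ 2 / 2)) - 1 - -(x ^ 2 / 2)),
      pow_nonneg (abs_nonneg x) 3]
  · have hexp : Real.exp (-(x ^ 2 / 2)) ≤ 1 := Real.exp_le_one_iff.2 (neg_nonpos.2 (by positivity))
    have hpow : |x| ^ 2 ≤ |x| ^ 3 := pow_le_pow_right₀ hx.le (by norm_num)
    rw [sq_abs] at hpow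
    linarith [sq_nonneg x]

section OneVariable

variable {α : Type*} [MeasurableSpace α] {μ : Measure α} [IsProbabilityMeasure μ] {X : α → ℝ}
  {s : ℝ}

lemma norm_integral_exp_sub_le (hX : MemLp X 3 μ) (h0 : ∫ a, X a ∂μ = 0)
    (h2 : ∫ a, X a ^ 2 ∂μ = s ^ 2) (c : ℝ) :
    ‖∫ a, Complex.exp ((c * X a : ℝ) * Complex.I) ∂μ - ((1 - (c * s) ^ 2 / 2 : ℝ) : ℂ)‖ ≤
      4 * |c| ^ 3 * ∫ a, |X a| ^ 3 ∂μ := by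
  have hX1 : Integrable X μ := hX.integrable (by norm_num)
  have hX2 : Integrable (fun a => X a ^ 2) μ := (hX.mono_exponent (by norm_num)).integrable_sq
  have hX3 : Integrable (fun a => |X a| ^ 3) μ := hX.integrable_norm_pow (by norm_num)
  have hlin : Integrable (fun a => ((c * X a : ℝ) : ℂ) * Complex.I) μ :=
    (hX1.const_mul c).ofReal.mul_const _
  have hquad : Integrable (fun a => (((c * X a) ^ 2 / 2 : ℝ) : ℂ)) μ := by
    simp_rw [mul_pow]
    exact ((hX2.const_mul _).div_const 2).ofReal
  have htaylor : ∫ a, (1 + ((c * X a : ℝ) : ℂ) * Complex.I - (((c * X a) ^ 2 / 2 : ℝ) : ℂ)) ∂μ =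
      ((1 - (c * s) ^ 2 / 2 : ℝ) : ℂ) := by
    rw [integral_sub ((integrable_const _).fun_add hlin) hquad,
      integral_add (integrable_const _) hlin, integral_mul_const, integral_complex_ofReal,
      integral_complex_ofReal, integral_const_mul, h0]
    simp_rw [mul_pow]
    rw [integral_div, integral_const_mul, h2]
    simp
  have hexp : Integrable (fun a => Complex.exp ((c * X a : ℝ) * Complex.I)) μ :=
    Integrable.of_bound (Complex.continuous_exp.comp_aestronglyMeasurable hlin.1) 1
      (ae_of_all _ fun a => (Complex.norm_exp_ofReal_mul_I _).le)
  have hpoly : Integrable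
      (fun a => 1 + ((c * X a : ℝ) : ℂ) * Complex.I - (((c * X a) ^ 2 / 2 : ℝ) : ℂ)) μ :=
    ((integrable_const _).add hlin).sub hquad
  rw [← htaylor, ← integral_sub hexp hpoly, ← integral_const_mul]
  refine norm_integral_le_of_norm_le (hX3.const_mul _) (ae_of_all _ fun a => ?_)
  calc _ ≤ 4 * |c * X a| ^ 3 :=
        norm_exp_ofReal_mul_I_sub_taylor_le (c * X a)
    _ = 4 * |c| ^ 3 * |X a| ^ 3 := by rw [abs_mul, mul_pow, mul_assoc]

lemma abs_pow_three_le_integral_abs_pow_three (hX : MemLp X 3 μ)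
    (h2 : ∫ a, X a ^ 2 ∂μ = s ^ 2) : |s| ^ 3 ≤ ∫ a, |X a| ^ 3 ∂μ := by
  have hX2 : Integrable (fun a => X a ^ 2) μ := (hX.mono_exponent (by norm_num)).integrable_sq
  have hX3 : Integrable (fun a => |X a| ^ 3) μ := hX.integrable_norm_pow (by norm_num)
  have htangent : ∀ u : ℝ, 3 / 2 * |s| * u ^ 2 - |s| ^ 3 / 2 ≤ |u| ^ 3 := fun u => by
    rw [← sq_abs u]
    nlinarith [mul_nonneg (sq_nonneg (|u| - |s|)) (by positivity : 0 ≤ 2 * |u| + |s|)]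
  calc |s| ^ 3 = ∫ a, (3 / 2 * |s| * X a ^ 2 - |s| ^ 3 / 2) ∂μ := by
        rw [integral_sub (hX2.const_mul _) (integrable_const _), integral_const_mul, h2, ← sq_abs s]
        simp only [integral_const, probReal_univ, one_smul]
        ring
    _ ≤ ∫ a, |X a| ^ 3 ∂μ :=
        integral_mono ((hX2.const_mul _).sub (integrable_const _)) hX3 fun a => htangent (X a)

lemma norm_integral_exp_sub_exp_le (hX : MemLp X 3 μ) (h0 : ∫ a, X a ∂μ = 0)
    (h2 : ∫ a, X a ^ 2 ∂μ = s ^ 2) (c : ℝ) :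
    ‖∫ a, Complex.exp ((c * X a : ℝ) * Complex.I) ∂μ - (Real.exp (-((c * s) ^ 2 / 2)) : ℝ)‖ ≤
      5 * |c| ^ 3 * ∫ a, |X a| ^ 3 ∂μ := by
  have hgauss : ‖((1 - (c * s) ^ 2 / 2 : ℝ) : ℂ) - (Real.exp (-((c * s) ^ 2 / 2)) : ℝ)‖ ≤
      |c| ^ 3 * ∫ a, |X a| ^ 3 ∂μ := by
    rw [← Complex.ofReal_sub, Complex.norm_real, Real.norm_eq_abs, abs_sub_comm]
    refine (abs_exp_neg_half_sq_sub_le (c * s)).trans ?_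
    rw [abs_mul, mul_pow]
    gcongr
    exact abs_pow_three_le_integral_abs_pow_three hX h2
  refine (norm_sub_le_norm_sub_add_norm_sub _ _ _).trans
    ((add_le_add (norm_integral_exp_sub_le hX h0 h2 c) hgauss).trans_eq ?_)
  ring

end OneVariable

lemma norm_integral_exp_sum_sub_exp_le {α ι : Type*} [Fintype ι] [MeasurableSpace α]
    {μ : Measure α} [IsProbabilityMeasure μ] {X : ι → α → ℝ} {s : ℝ} (hind : iIndepFun X μ)
    (hX : ∀ i, MemLp (X i) 3 μ) (h0 : ∀ i, ∫ a, X i a ∂μ = 0)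
    (h2 : ∀ i, ∫ a, X i a ^ 2 ∂μ = s ^ 2) (c : ι → ℝ) :
    ‖∫ a, Complex.exp ((∑ i, c i * X i a : ℝ) * Complex.I) ∂μ -
        (Real.exp (-(s ^ 2 / 2 * ∑ i, c i ^ 2)) : ℝ)‖ ≤
      ∑ i, 5 * |c i| ^ 3 * ∫ a, |X i a| ^ 3 ∂μ := by
  have hprod : ∫ a, Complex.exp ((∑ i, c i * X i a : ℝ) * Complex.I) ∂μ =
      ∏ i, ∫ a, Complex.exp ((c i * X i a : ℝ) * Complex.I) ∂μ := by
    rw [← hind.integral_fun_prod_comp (f := fun i x => Complex.exp ((c i * x : ℝ) * Complex.I))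
      (fun i => (hX i).aemeasurable) (fun i => by fun_prop)]
    simp_rw [← Complex.exp_sum, Complex.ofReal_sum, Finset.sum_mul]
  have hgauss : ((Real.exp (-(s ^ 2 / 2 * ∑ i, c i ^ 2)) : ℝ) : ℂ) =
      ∏ i, ((Real.exp (-((c i * s) ^ 2 / 2)) : ℝ) : ℂ) := by
    rw [← Complex.ofReal_prod, ← Real.exp_sum, Finset.sum_neg_distrib, Finset.mul_sum]
    congr 4 with i
    ring
  rw [hprod, hgauss]
  refine (norm_prod_sub_prod_le_sum _ _ _ (fun i _ => ?_) fun i _ => ?_).trans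
    (Finset.sum_le_sum fun i _ => norm_integral_exp_sub_exp_le (hX i) (h0 i) (h2 i) (c i))
  · exact (norm_integral_le_of_norm_le_const (C := 1) (ae_of_all _ fun a =>
      (Complex.norm_exp_ofReal_mul_I _).le)).trans (by simp)
  · rw [Complex.norm_real, Real.norm_of_nonneg (Real.exp_pos _).le, Real.exp_le_one_iff, neg_nonpos]
    positivity

end CharacteristicFunctions

section MomentMatrix

variable {p : ℕ}

/-- A square matrix bordered by a zero row and a zero column in front. -/
def borderZero (S : Matrix (Fin p) (Fin p) ℝ) : Matrix (Fin (p + 1)) (Fin (p + 1)) ℝ :=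
  Matrix.of (Fin.cons 0 fun k => Fin.cons 0 (S k))

/-- The second moment matrix of `(1, X)` for a random vector `X` with mean `m` and covariance matrix
`S`, which is the limit of the normalized Gram matrices. -/
def momentMatrix (m : Fin p → ℝ) (S : Matrix (Fin p) (Fin p) ℝ) :
    Matrix (Fin (p + 1)) (Fin (p + 1)) ℝ :=
  Matrix.vecMulVec (Matrix.vecCons 1 m) (Matrix.vecCons 1 m) + borderZero S

lemma continuous_momentMatrix :
    Continuous fun x : (Fin p → ℝ) × Matrix (Fin p) (Fin p) ℝ => momentMatrix x.1 x.2 := by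
  unfold momentMatrix borderZero
  fun_prop

lemma single_vecMul_momentMatrix (b : ℝ) (m : Fin p → ℝ) (S : Matrix (Fin p) (Fin p) ℝ) :
    Pi.single 0 b ᵥ* momentMatrix m S = b • Matrix.vecCons 1 m := by
  ext l
  simp [momentMatrix, borderZero]

lemma dotProduct_momentMatrix_mulVec (m : Fin p → ℝ) (S : Matrix (Fin p) (Fin p) ℝ)
    (x : Fin (p + 1) → ℝ) :
    x ⬝ᵥ momentMatrix m S *ᵥ x =
      (Matrix.vecCons 1 m ⬝ᵥ x) ^ 2 + Fin.tail x ⬝ᵥ S *ᵥ Fin.tail x := by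
  have hborder : x ⬝ᵥ borderZero S *ᵥ x = Fin.tail x ⬝ᵥ S *ᵥ Fin.tail x := by
    simp [borderZero, dotProduct, Matrix.mulVec, Fin.sum_univ_succ, Fin.tail]
  rw [momentMatrix, Matrix.add_mulVec, dotProduct_add, hborder, Matrix.vecMulVec_mulVec,
    dotProduct_smul, dotProduct_comm x, op_smul_eq_smul, smul_eq_mul, sq]

lemma isUnit_momentMatrix (m : Fin p → ℝ) {S : Matrix (Fin p) (Fin p) ℝ} (hS : S.PosDef) :
    IsUnit (momentMatrix m S) := by
  rw [← Matrix.mulVec_injective_iff_isUnit, ← Matrix.coe_mulVecLin, ← LinearMap.ker_eq_bot,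
    LinearMap.ker_eq_bot']
  intro x hx
  have hquad := dotProduct_momentMatrix_mulVec m S x
  rw [← Matrix.mulVecLin_apply, hx, dotProduct_zero] at hquad
  have htail : Fin.tail x = 0 := by
    by_contra hne
    have hpos := hS.dotProduct_mulVec_pos hne
    rw [star_trivial] at hpos
    linarith [sq_nonneg (Matrix.vecCons 1 m ⬝ᵥ x)]
  have hhead : x 0 = 0 := by
    have hsucc : ∀ k : Fin p, x k.succ = 0 := congrFun htail
    simpa [htail, dotProduct, Fin.sum_univ_succ, hsucc] using hquad.symm
  rw [← Fin.cons_self_tail x, htail, hhead]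
  ext k
  refine Fin.cases ?_ (fun k => ?_) k <;> simp

lemma isUnit_det_smul_momentMatrix {a : ℝ} (ha : a ≠ 0) (m : Fin p → ℝ)
    {S : Matrix (Fin p) (Fin p) ℝ} (hS : S.PosDef) : IsUnit (a • momentMatrix m S).det :=
  (Matrix.isUnit_iff_isUnit_det _).1 ((isUnit_momentMatrix m hS).smul (Units.mk0 a ha))

lemma vecMul_inv_smul_momentMatrix {a : ℝ} (ha : a ≠ 0) (m : Fin p → ℝ)
    {S : Matrix (Fin p) (Fin p) ℝ} (hS : S.PosDef) :
    Matrix.vecCons 1 m ᵥ* (a • momentMatrix m S)⁻¹ = Pi.single 0 a⁻¹ := by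
  have hrow : Pi.single 0 a⁻¹ ᵥ* (a • momentMatrix m S) = Matrix.vecCons 1 m := by
    rw [Matrix.vecMul_smul, single_vecMul_momentMatrix, smul_inv_smul₀ ha]
  rw [← hrow, Matrix.vecMul_vecMul,
    Matrix.mul_nonsing_inv _ (isUnit_det_smul_momentMatrix ha m hS), Matrix.vecMul_one]

section Limits

variable {β : Type*} {l : Filter β} {G : β → Matrix (Fin (p + 1)) (Fin (p + 1)) ℝ} {a : ℝ}
  {m : Fin p → ℝ} {S : Matrix (Fin p) (Fin p) ℝ}

lemma eventually_isUnit_det_of_tendsto (ha : a ≠ 0) (hS : S.PosDef)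
    (hG : Tendsto G l (𝓝 (a • momentMatrix m S))) : ∀ᶠ x in l, IsUnit (G x).det := by
  filter_upwards [((continuous_id.matrix_det.tendsto _).comp hG).eventually_ne
    (isUnit_det_smul_momentMatrix ha m hS).ne_zero] with x hx
  exact hx.isUnit

lemma tendsto_vecMul_inv {u : β → Fin p → ℝ} (ha : a ≠ 0) (hS : S.PosDef)
    (hu : Tendsto u l (𝓝 m)) (hG : Tendsto G l (𝓝 (a • momentMatrix m S))) :
    Tendsto (fun x => Matrix.vecCons 1 (u x) ᵥ* (G x)⁻¹) l (𝓝 (Pi.single 0 a⁻¹)) := by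
  have hinv : Tendsto (fun x => (G x)⁻¹) l (𝓝 (a • momentMatrix m S)⁻¹) :=
    (continuousAt_matrix_inv _ (NormedRing.inverse_continuousAt
      (isUnit_det_smul_momentMatrix ha m hS).unit)).tendsto.comp hG
  have hvec : Tendsto (fun x => Matrix.vecCons 1 (u x)) l (𝓝 (Matrix.vecCons 1 m)) :=
    tendsto_const_nhds.matrixVecCons hu
  rw [← vecMul_inv_smul_momentMatrix ha m hS]
  exact ((continuous_fst.matrix_vecMul continuous_snd).tendsto (_, _)).comp (hvec.prodMk_nhds hinv)

end Limits

end MomentMatrix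

section MeasurableMatrix

variable {α ι : Type*} [MeasurableSpace α] [Fintype ι] [DecidableEq ι] {A : α → Matrix ι ι ℝ}

lemma measurable_matrix_det (hA : ∀ i j, Measurable fun a => A a i j) :
    Measurable fun a => (A a).det := by
  simp only [Matrix.det_apply]
  exact Finset.measurable_sum _ fun σ _ =>
    (Finset.measurable_prod _ fun i _ => hA _ _).const_smul _

lemma measurable_matrix_inv (hA : ∀ i j, Measurable fun a => A a i j) (i j : ι) :
    Measurable fun a => (A a)⁻¹ i j := by
  simp only [Matrix.inv_def, Matrix.smul_apply, Ring.inverse_eq_inv', smul_eq_mul,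
    Matrix.adjugate_apply]
  refine (measurable_matrix_det hA).inv.mul (measurable_matrix_det fun k l => ?_)
  rcases eq_or_ne k j with rfl | hk
  · simp
  · simpa [Matrix.updateRow_ne hk] using hA k l

end MeasurableMatrix

lemma measurable_vecCons {p : ℕ} (k : Fin (p + 1)) :
    Measurable fun x : Fin p → ℝ => Matrix.vecCons 1 x k := by
  cases k using Fin.cases
  · exact measurable_const
  · exact measurable_pi_apply _

lemma sqrt_mul_dotProduct_inv_mulVec {ι : Type*} [Fintype ι] [DecidableEq ι] (t : ℝ) (v s : ι → ℝ)
    {G : Matrix ι ι ℝ} (hG : IsUnit G.det) :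
    √t * (v ⬝ᵥ G⁻¹ *ᵥ s) = v ᵥ* (t⁻¹ • G)⁻¹ ⬝ᵥ (√t)⁻¹ • s := by
  rcases eq_or_ne t 0 with rfl | ht
  · simp
  have hinv : (t⁻¹ • G)⁻¹ = t • G⁻¹ := by
    refine Matrix.inv_eq_right_inv ?_
    rw [Matrix.smul_mul, Matrix.mul_smul, Matrix.mul_nonsing_inv _ hG, smul_smul,
      inv_mul_cancel₀ ht, one_smul]
  rw [hinv, Matrix.dotProduct_mulVec, Matrix.vecMul_smul, smul_dotProduct, dotProduct_smul,
    smul_eq_mul, smul_eq_mul, ← mul_assoc, ← div_eq_mul_inv, Real.div_sqrt]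

namespace Experiment

variable {n p : ℕ} {Ω : Type*} [MeasurableSpace Ω] (D : Experiment n p Ω)

/-- The regressors `(1, X_i)` of unit `i`. -/
def regressor (i : Fin n) (ω : Ω) : Fin (p + 1) → ℝ := Matrix.vecCons 1 (D.X i ω)

/-- The indicator that unit `i` is in arm `w`. -/
def armInd (w : Bool) (i : Fin n) (ω : Ω) : ℝ := if D.W i ω = w then 1 else 0

/-- The Gram matrix of the regression in arm `w`, as a sum over all units. -/
def gram (w : Bool) (ω : Ω) : Matrix (Fin (p + 1)) (Fin (p + 1)) ℝ :=
  Matrix.of fun k l => ∑ i, D.armInd w i ω * (D.regressor i ω k * D.regressor i ω l)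

/-- The score of the regression in arm `w`: the regressors of the arm times the errors. -/
def score (w : Bool) (ω : Ω) : Fin (p + 1) → ℝ :=
  fun k => ∑ i, D.armInd w i ω * (D.regressor i ω k * D.ε i ω)

/-- The true coefficients (intercept first) of arm `w`, which `betaHat` estimates. -/
def beta (w : Bool) : Fin (p + 1) → ℝ := Matrix.vecCons (D.α w) (D.η w)

section Algebra

lemma sum_arm_eq (w : Bool) (ω : Ω) (f : Fin n → ℝ) :
    ∑ i : {i : Fin n // D.W i ω = w}, f i = ∑ i, D.armInd w i ω * f i := by
  simp only [armInd, ite_mul, one_mul, zero_mul]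
  rw [← Finset.sum_filter]
  exact (Finset.sum_subtype _ (by simp) f).symm

lemma armMatrix_transpose_mul_self (w : Bool) (ω : Ω) :
    (D.armMatrix w ω)ᵀ * D.armMatrix w ω = D.gram w ω := by
  ext k l
  exact D.sum_arm_eq w ω fun i => D.regressor i ω k * D.regressor i ω l

lemma surface_eq_dotProduct (w : Bool) (x : Fin p → ℝ) :
    D.surface w x = Matrix.vecCons 1 x ⬝ᵥ D.beta w := by
  rw [surface, beta, Matrix.cons_dotProduct_cons, one_mul, dotProduct_comm]

lemma armInd_mul_Y (w : Bool) (i : Fin n) (ω : Ω) :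
    D.armInd w i ω * D.Y i ω = D.armInd w i ω * (D.regressor i ω ⬝ᵥ D.beta w + D.ε i ω) := by
  by_cases hw : D.W i ω = w
  · rw [Y, hw, surface_eq_dotProduct, regressor]
  · simp [armInd, hw]

lemma armMatrix_transpose_mulVec (w : Bool) (ω : Ω) :
    (D.armMatrix w ω)ᵀ *ᵥ D.armResponse w ω = D.gram w ω *ᵥ D.beta w + D.score w ω := by
  ext k
  calc ((D.armMatrix w ω)ᵀ *ᵥ D.armResponse w ω) k
      = ∑ i, D.armInd w i ω * (D.regressor i ω k * D.Y i ω) :=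
        D.sum_arm_eq w ω fun i => D.regressor i ω k * D.Y i ω
    _ = ∑ i, (∑ l, D.armInd w i ω * (D.regressor i ω k * D.regressor i ω l) * D.beta w l +
          D.armInd w i ω * (D.regressor i ω k * D.ε i ω)) := by
        refine Finset.sum_congr rfl fun i _ => ?_
        rw [mul_left_comm, armInd_mul_Y, dotProduct, mul_add, mul_add, Finset.mul_sum,
          Finset.mul_sum]
        congr 1
        · exact Finset.sum_congr rfl fun l _ => by ring
        · ring
    _ = (D.gram w ω *ᵥ D.beta w + D.score w ω) k := by
        simp only [Finset.sum_add_distrib, Pi.add_apply, score, Matrix.mulVec, dotProduct, gram,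
          Matrix.of_apply, Finset.sum_mul]
        rw [Finset.sum_comm]

lemma betaHat_eq (w : Bool) (ω : Ω) :
    D.betaHat w ω = (D.gram w ω)⁻¹ *ᵥ (D.gram w ω *ᵥ D.beta w + D.score w ω) := by
  rw [betaHat, armMatrix_transpose_mul_self, armMatrix_transpose_mulVec]

lemma betaHat_eq_beta_add {w : Bool} {ω : Ω} (h : IsUnit (D.gram w ω).det) :
    D.betaHat w ω = D.beta w + (D.gram w ω)⁻¹ *ᵥ D.score w ω := by
  rw [betaHat_eq, Matrix.mulVec_add, Matrix.mulVec_mulVec, Matrix.nonsing_inv_mul _ h,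
    Matrix.one_mulVec]

lemma sampleCov_apply (hn : n ≠ 0) (ω : Ω) (k l : Fin p) :
    D.sampleCov ω k l =
      (1 / (n : ℝ)) * ∑ i, D.X i ω k * D.X i ω l - D.xbar ω k * D.xbar ω l := by
  have hn' : (n : ℝ) ≠ 0 := Nat.cast_ne_zero.2 hn
  have hsum : ∀ k, ∑ i, D.X i ω k = n * D.xbar ω k := fun k => by
    rw [xbar, ← mul_assoc, mul_one_div_cancel hn', one_mul]
  simp only [sampleCov, Matrix.of_apply, sub_mul, mul_sub, Finset.sum_sub_distrib, ← Finset.sum_mul,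
    ← Finset.mul_sum, hsum, Finset.sum_const, Finset.card_univ, Fintype.card_fin, nsmul_eq_mul]
  field_simp
  ring

lemma average_regressor_mul_regressor (hn : n ≠ 0) (ω : Ω) (k l : Fin (p + 1)) :
    (1 / (n : ℝ)) * ∑ i, D.regressor i ω k * D.regressor i ω l =
      momentMatrix (D.xbar ω) (D.sampleCov ω) k l := by
  have hn' : (n : ℝ) ≠ 0 := Nat.cast_ne_zero.2 hn
  cases k using Fin.cases with
  | zero => cases l using Fin.cases <;> simp [regressor, momentMatrix, borderZero, xbar, hn']
  | succ k =>
    cases l using Fin.cases with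
    | zero => simp [regressor, momentMatrix, borderZero, xbar]
    | succ l => simp [regressor, momentMatrix, borderZero, sampleCov_apply, hn]

end Algebra

section Measurability

lemma measurable_design : Measurable D.design :=
  (measurable_pi_lambda _ D.measurable_X).prodMk (measurable_pi_lambda _ D.measurable_W)

lemma measurable_errors : Measurable D.errors := measurable_pi_lambda _ D.measurable_ε

lemma designSigma_le : D.designSigma ≤ ‹MeasurableSpace Ω› := D.measurable_design.comap_le

lemma measurable_regressor_designSigma (i : Fin n) (k : Fin (p + 1)) :
    Measurable[D.designSigma] fun ω => D.regressor i ω k := by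
  have hX : Measurable[D.designSigma] (D.X i) :=
    ((measurable_pi_apply i).comp measurable_fst).comp (comap_measurable D.design)
  exact (measurable_vecCons k).comp hX

lemma measurable_armInd_designSigma (w : Bool) (i : Fin n) :
    Measurable[D.designSigma] (D.armInd w i) := by
  refine Measurable.comp (g := fun z => if z.2 i = w then (1 : ℝ) else 0) ?_
    (comap_measurable D.design)
  exact (measurable_of_countable fun b : Bool => if b = w then (1 : ℝ) else 0).comp
    ((measurable_pi_apply i).comp measurable_snd)

lemma measurable_regressor (i : Fin n) (k : Fin (p + 1)) : Measurable fun ω => D.regressor i ω k :=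
  (D.measurable_regressor_designSigma i k).mono D.designSigma_le le_rfl

lemma measurable_armInd (w : Bool) (i : Fin n) : Measurable (D.armInd w i) :=
  (D.measurable_armInd_designSigma w i).mono D.designSigma_le le_rfl

lemma measurable_gram (w : Bool) (k l : Fin (p + 1)) : Measurable fun ω => D.gram w ω k l := by
  simp only [gram, Matrix.of_apply]
  exact Finset.measurable_sum _ fun i _ => (D.measurable_armInd w i).mul
    ((D.measurable_regressor i k).mul (D.measurable_regressor i l))

lemma measurable_score (w : Bool) (k : Fin (p + 1)) : Measurable fun ω => D.score w ω k :=
  Finset.measurable_sum _ fun i _ => (D.measurable_armInd w i).mul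
    ((D.measurable_regressor i k).mul (D.measurable_ε i))

lemma measurable_betaHat (w : Bool) (k : Fin (p + 1)) : Measurable fun ω => D.betaHat w ω k := by
  simp only [betaHat_eq, Matrix.mulVec, dotProduct, Pi.add_apply]
  exact Finset.measurable_sum _ fun l _ =>
    (measurable_matrix_inv (D.measurable_gram w) k l).mul
      ((Finset.measurable_sum _ fun j _ => (D.measurable_gram w l j).mul_const _).add
        (D.measurable_score w l))

lemma measurable_tauHat (P : Measure Ω) : Measurable (D.tauHat P) := by
  have hdot : ∀ (w : Bool) (v : Fin (p + 1) → ℝ), Measurable fun ω => v ⬝ᵥ D.betaHat w ω :=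
    fun w v => Finset.measurable_sum _ fun k _ => (D.measurable_betaHat w k).const_mul _
  exact (hdot true _).sub (hdot false _)

end Measurability

end Experiment

section Conditioning

variable {α β γ : Type*} [MeasurableSpace α] [MeasurableSpace β] [MeasurableSpace γ]
  {μ : Measure α} {f : α → β} {g : α → γ}

lemma map_cond_of_indepFun [IsFiniteMeasure μ] (hf : Measurable f) (hg : Measurable g)
    (h : IndepFun f g μ) {s : Set γ} (hs : MeasurableSet s) (hμ : μ (g ⁻¹' s) ≠ 0) :
    (μ[|g ⁻¹' s]).map f = μ.map f := by
  ext t ht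
  rw [Measure.map_apply hf ht, Measure.map_apply hf ht, cond_apply (hg hs), Set.inter_comm,
    h.measure_inter_preimage_eq_mul _ _ ht hs, mul_comm, mul_assoc,
    ENNReal.mul_inv_cancel hμ (measure_ne_top _ _), mul_one]

lemma integral_cond_of_indepFun [IsFiniteMeasure μ] (hf : Measurable f) (hg : Measurable g)
    (h : IndepFun f g μ) {s : Set γ} (hs : MeasurableSet s) (hμ : μ (g ⁻¹' s) ≠ 0) {φ : β → ℝ}
    (hφ : Measurable φ) : ∫ a, φ (f a) ∂(μ[|g ⁻¹' s]) = ∫ a, φ (f a) ∂μ := by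
  rw [← integral_map hf.aemeasurable hφ.aestronglyMeasurable,
    map_cond_of_indepFun hf hg h hs hμ, integral_map hf.aemeasurable hφ.aestronglyMeasurable]

lemma integrable_cond {f : α → ℝ} {s : Set α} (hf : Integrable f μ) (hμ : μ s ≠ 0) :
    Integrable f (μ[|s]) :=
  hf.restrict.smul_measure (ENNReal.inv_ne_top.2 hμ)

lemma ae_eq_const_of_indepFun_of_ae_eq_comp [MeasurableSingletonClass β]
    [MeasurableSingletonClass γ] (h : IndepFun f g μ) {φ : γ → β} (hφ : f =ᵐ[μ] φ ∘ g) {c : γ}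
    (hc : μ (g ⁻¹' {c}) ≠ 0) : f =ᵐ[μ] fun _ => φ c := by
  have hnull : μ (f ⁻¹' {φ c}ᶜ ∩ g ⁻¹' {c}) = 0 := by
    refine measure_mono_null ?_ (ae_iff.1 hφ)
    rintro a ⟨hfa, rfl⟩ hφa
    exact hfa hφa
  rw [h.measure_inter_preimage_eq_mul _ _ (measurableSet_singleton _).compl
    (measurableSet_singleton c)] at hnull
  exact (mul_eq_zero.1 hnull).resolve_right hc

end Conditioning

/-- The probability of arm `w` when the treatment probability is `q`. -/
def armProb (q : ℝ) (w : Bool) : ℝ := if w then q else 1 - q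

lemma armProb_pos {q : ℝ} (h₀ : 0 < q) (h₁ : q < 1) (w : Bool) : 0 < armProb q w := by
  cases w <;> simpa [armProb]

lemma continuous_armProb (w : Bool) : Continuous fun q => armProb q w := by
  cases w
  · exact continuous_const.sub continuous_id
  · exact continuous_id

namespace Experiment

variable {n p : ℕ} {Ω : Type*} [MeasurableSpace Ω] {D : Experiment n p Ω} {P : Measure Ω}
  {q σ : ℝ} {C : ℝ≥0}

section Moments

lemma FourthMomentsLE.eLpNorm_error_le (h : D.FourthMomentsLE P C) (i : Fin n) :
    eLpNorm (D.ε i) 4 P ≤ max 1 C :=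
  eLpNorm_natCast_le_of_lintegral_pow_le four_ne_zero (h i).2

lemma eLpNorm_armInd_mul_le (w : Bool) (i : Fin n) (f : Ω → ℝ) (r : ℝ≥0∞) :
    eLpNorm (fun ω => D.armInd w i ω * f ω) r P ≤ eLpNorm f r P := by
  refine eLpNorm_mono fun ω => ?_
  unfold armInd
  split_ifs <;> simp

lemma measurable_xbar (k : Fin p) : Measurable fun ω => D.xbar ω k :=
  (Finset.measurable_sum _ fun i _ => (measurable_pi_apply k).comp (D.measurable_X i)).const_mul _

variable [IsProbabilityMeasure P]

lemma FourthMomentsLE.eLpNorm_regressor_le (h : D.FourthMomentsLE P C) (i : Fin n)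
    (k : Fin (p + 1)) : eLpNorm (fun ω => D.regressor i ω k) 4 P ≤ max 1 C := by
  cases k using Fin.cases with
  | zero => simp [regressor, eLpNorm_const _ _ (IsProbabilityMeasure.ne_zero P)]
  | succ k => exact eLpNorm_natCast_le_of_lintegral_pow_le four_ne_zero ((h i).1 k)

lemma FourthMomentsLE.eLpNorm_regressor_mul_regressor_le (h : D.FourthMomentsLE P C) (i : Fin n)
    (k l : Fin (p + 1)) :
    eLpNorm (fun ω => D.regressor i ω k * D.regressor i ω l) 2 P ≤ max 1 C * max 1 C :=
  (eLpNorm_two_mul_le (D.measurable_regressor i k).aestronglyMeasurable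
    (D.measurable_regressor i l).aestronglyMeasurable).trans
    (mul_le_mul' (h.eLpNorm_regressor_le i k) (h.eLpNorm_regressor_le i l))

lemma FourthMomentsLE.eLpNorm_score_summand_le (h : D.FourthMomentsLE P C) (w : Bool) (i : Fin n)
    (k : Fin (p + 1)) :
    eLpNorm (fun ω => D.armInd w i ω * (D.regressor i ω k * D.ε i ω)) 2 P ≤
      max 1 C * max 1 C :=
  (eLpNorm_armInd_mul_le w i _ 2).trans <|
    (eLpNorm_two_mul_le (D.measurable_regressor i k).aestronglyMeasurable
      (D.measurable_ε i).aestronglyMeasurable).trans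
      (mul_le_mul' (h.eLpNorm_regressor_le i k) (h.eLpNorm_error_le i))

lemma FourthMomentsLE.memLp_score_summand (h : D.FourthMomentsLE P C) (w : Bool) (i : Fin n)
    (k : Fin (p + 1)) :
    MemLp (fun ω => D.armInd w i ω * (D.regressor i ω k * D.ε i ω)) 2 P :=
  ⟨((D.measurable_armInd w i).mul
      ((D.measurable_regressor i k).mul (D.measurable_ε i))).aestronglyMeasurable,
    (h.eLpNorm_score_summand_le w i k).trans_lt (by finiteness)⟩

lemma FourthMomentsLE.memLp_feature (h : D.FourthMomentsLE P C) (i : Fin n) (k : Fin p) :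
    MemLp (fun ω => D.X i ω k) 4 P :=
  ⟨((measurable_pi_apply k).comp (D.measurable_X i)).aestronglyMeasurable,
    (h.eLpNorm_regressor_le i k.succ).trans_lt (by simp)⟩

lemma FourthMomentsLE.integrable_feature (h : D.FourthMomentsLE P C) (i : Fin n) (k : Fin p) :
    Integrable (fun ω => D.X i ω k) P :=
  (h.memLp_feature i k).integrable (by norm_num)

lemma FourthMomentsLE.eLpNorm_xbar_le (h : D.FourthMomentsLE P C) (k : Fin p) :
    eLpNorm (fun ω => D.xbar ω k) 2 P ≤ max 1 C :=
  (eLpNorm_le_eLpNorm_of_exponent_le (by norm_num)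
      (measurable_xbar k).aestronglyMeasurable).trans
    (eLpNorm_average_le (by norm_num) (fun i => (h.memLp_feature i k).1)
      fun i => h.eLpNorm_regressor_le i k.succ)

lemma FourthMomentsLE.integral_xbar (h : D.FourthMomentsLE P C) (k : Fin p) :
    ∫ ω, D.xbar ω k ∂P = (1 / (n : ℝ)) * ∑ i, ∫ ω, D.X i ω k ∂P := by
  simp only [xbar]
  rw [integral_const_mul, integral_finsetSum _ fun i _ => h.integrable_feature i k]

end Moments

section Treatments

variable [IsProbabilityMeasure P]

lemma measurable_treatments : Measurable D.treatments := measurable_pi_lambda _ D.measurable_W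

lemma measurable_features : Measurable D.features := measurable_pi_lambda _ D.measurable_X

lemma measurable_indirect (i : Fin n) : Measurable (D.indirect i) :=
  measurable_pi_lambda _ fun j => D.measurable_W j

lemma setOf_forall_W_eq (w : Bool) :
    {ω | ∀ j, D.W j ω = w} = D.treatments ⁻¹' {fun _ => w} := by
  ext ω
  simp [treatments, funext_iff]

lemma setOf_forall_indirect_eq (i : Fin n) (w : Bool) :
    {ω | ∀ j, D.indirect i ω j = w} = D.indirect i ⁻¹' {fun _ => w} := by
  ext ω
  simp [funext_iff]

lemma Regular.measure_arm (h : D.Regular P q σ) (i : Fin n) (w : Bool) :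
    P {ω | D.W i ω = w} = ENNReal.ofReal (armProb q w) := by
  cases w with
  | true => simpa [armProb] using h.treatments_law i
  | false =>
    have hcompl : {ω | D.W i ω = false} = {ω | D.W i ω = true}ᶜ := by ext; simp
    have hmeas : MeasurableSet {ω | D.W i ω = true} :=
      D.measurable_W i (measurableSet_singleton true)
    rw [hcompl, prob_compl_eq_one_sub hmeas,
      h.treatments_law i, ← ENNReal.ofReal_one, ← ENNReal.ofReal_sub _ h.prob_pos.le]
    simp [armProb]

lemma Regular.measure_forall_W_eq_ne_zero (h : D.Regular P q σ) (w : Bool) :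
    P {ω | ∀ j, D.W j ω = w} ≠ 0 := by
  have hprod := h.treatments_indep.measure_inter_preimage_eq_mul Finset.univ
    (sets := fun _ => {w}) fun _ _ => measurableSet_singleton w
  have hset : (⋂ i ∈ Finset.univ, D.W i ⁻¹' {w}) = {ω | ∀ j, D.W j ω = w} := by ext; simp
  rw [← hset, hprod, Finset.prod_ne_zero_iff]
  intro i _
  refine (h.measure_arm i w).trans_ne ?_
  simpa using armProb_pos h.prob_pos h.prob_lt_one w

lemma Regular.measure_forall_indirect_eq_ne_zero (h : D.Regular P q σ) (i : Fin n) (w : Bool) :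
    P {ω | ∀ j, D.indirect i ω j = w} ≠ 0 := fun h₀ =>
  h.measure_forall_W_eq_ne_zero w (measure_mono_null (fun _ hω (j : {j // j ≠ i}) => hω j) h₀)

lemma Regular.indepFun_features_treatments (h : D.Regular P q σ)
    (hfeat : D.FeaturesOfIndirect P ∨ IndepFun D.features D.treatments P)
    (hstatic : ∀ i, IndepFun (D.X i) (D.indirect i) P) :
    IndepFun D.features D.treatments P := by
  refine hfeat.elim (fun hdet => ?_) id
  choose x hx using hdet
  have hconst : ∀ i, D.X i =ᵐ[P] fun _ => x i fun _ => true := fun i =>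
    ae_eq_const_of_indepFun_of_ae_eq_comp (hstatic i) (hx i) <|
      setOf_forall_indirect_eq (D := D) i true ▸ h.measure_forall_indirect_eq_ne_zero i true
  have hfeatures : D.features =ᵐ[P] fun _ i => x i fun _ => true := by
    filter_upwards [ae_all_iff.2 hconst] with ω hω
    exact funext hω
  exact (indepFun_const_left _ D.treatments).congr hfeatures.symm ae_eq_rfl

lemma Regular.omega_eq (h : D.Regular P q σ) (hC : D.FourthMomentsLE P C)
    (hstatic : ∀ i, IndepFun (D.X i) (D.indirect i) P) (w : Bool) (k : Fin p) :
    D.omega P w k = ∫ ω, D.xbar ω k ∂P := by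
  rw [hC.integral_xbar, omega]
  congr 1
  refine Finset.sum_congr rfl fun i _ => ?_
  have hne := h.measure_forall_indirect_eq_ne_zero i w
  rw [setOf_forall_indirect_eq] at hne ⊢
  exact integral_cond_of_indepFun (D.measurable_X i) (measurable_indirect i) (hstatic i)
    (measurableSet_singleton fun _ => w) hne (measurable_pi_apply k)

lemma Regular.integrable_error (h : D.Regular P q σ) (i : Fin n) : Integrable (D.ε i) P :=
  (h.errors_memLp i).integrable one_le_two

lemma Regular.integral_error_cond (h : D.Regular P q σ) (i : Fin n) (w : Bool) :
    ∫ ω, D.ε i ω ∂(P[|{ω | ∀ j, D.W j ω = w}]) = 0 := by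
  have hE : MeasurableSet[D.designSigma] {ω | ∀ j, D.W j ω = w} :=
    ⟨{z | z.2 = fun _ => w}, measurable_snd (measurableSet_singleton _),
      (setOf_forall_W_eq w).symm⟩
  rw [ProbabilityTheory.cond, integral_smul_measure,
    ← setIntegral_condExp D.designSigma_le (h.integrable_error i) hE,
    integral_congr_ae (ae_restrict_of_ae (h.errors_exogenous i)), integral_zero, smul_zero]

lemma Regular.integral_Y_cond (h : D.Regular P q σ) (hC : D.FourthMomentsLE P C)
    (hind : IndepFun D.features D.treatments P) (i : Fin n) (w : Bool) :
    ∫ ω, D.Y i ω ∂(P[|{ω | ∀ j, D.W j ω = w}]) = D.surface w fun k => ∫ ω, D.X i ω k ∂P := by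
  have hne := h.measure_forall_W_eq_ne_zero w
  have hE : MeasurableSet {ω | ∀ j, D.W j ω = w} :=
    setOf_forall_W_eq (D := D) w ▸ measurable_treatments (measurableSet_singleton _)
  have hprob := cond_isProbabilityMeasure hne
  have hX : ∀ k, ∫ ω, D.X i ω k ∂(P[|{ω | ∀ j, D.W j ω = w}]) = ∫ ω, D.X i ω k ∂P := fun k => by
    rw [setOf_forall_W_eq] at hne ⊢
    exact integral_cond_of_indepFun measurable_features measurable_treatments hind
      (measurableSet_singleton _) hne (φ := fun x => x i k) (by fun_prop)
  have hηX : ∀ k, Integrable (fun ω => D.η w k * D.X i ω k) (P[|{ω | ∀ j, D.W j ω = w}]) :=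
    fun k => (integrable_cond (hC.integrable_feature i k) hne).const_mul _
  calc ∫ ω, D.Y i ω ∂(P[|{ω | ∀ j, D.W j ω = w}])
      = ∫ ω, D.α w + ∑ k, D.η w k * D.X i ω k + D.ε i ω ∂(P[|{ω | ∀ j, D.W j ω = w}]) := by
        refine integral_congr_ae ?_
        filter_upwards [ae_cond_mem hE] with ω hω
        rw [Y, hω i, surface, dotProduct]
    _ = D.surface w fun k => ∫ ω, D.X i ω k ∂P := by
        rw [integral_add ((integrable_const _).fun_add (integrable_finsetSum _ fun k _ => hηX k))
            (integrable_cond (h.integrable_error i) hne),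
          integral_add (integrable_const _) (integrable_finsetSum _ fun k _ => hηX k),
          h.integral_error_cond, integral_finsetSum _ fun k _ => hηX k]
        simp [integral_const_mul, hX, surface, dotProduct]

lemma average_surface (hn : n ≠ 0) (w : Bool) (x : Fin n → Fin p → ℝ) :
    (1 / (n : ℝ)) * ∑ i, D.surface w (x i) =
      D.surface w fun k => (1 / (n : ℝ)) * ∑ i, x i k := by
  have hn' : (n : ℝ) ≠ 0 := Nat.cast_ne_zero.2 hn
  simp only [surface, dotProduct, Finset.sum_add_distrib, Finset.mul_sum, mul_add,
    Finset.sum_const, Finset.card_univ, Fintype.card_fin, nsmul_eq_mul]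
  rw [Finset.sum_comm, ← mul_assoc, one_div_mul_cancel hn', one_mul]
  simp only [mul_left_comm]

lemma Regular.gate_eq (h : D.Regular P q σ) (hC : D.FourthMomentsLE P C)
    (hind : IndepFun D.features D.treatments P) (hn : n ≠ 0) :
    D.gate P = D.surface true (fun k => ∫ ω, D.xbar ω k ∂P) -
      D.surface false fun k => ∫ ω, D.xbar ω k ∂P := by
  simp only [gate, h.integral_Y_cond hC hind, Finset.sum_sub_distrib, mul_sub,
    average_surface hn, hC.integral_xbar]

end Treatments

section ErrorKernel

/-- The regular conditional law of the error vector given the design. -/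
noncomputable abbrev errorKernel (D : Experiment n p Ω) (P : Measure Ω) [IsProbabilityMeasure P] :
    Kernel ((Fin n → Fin p → ℝ) × (Fin n → Bool)) (Fin n → ℝ) :=
  condDistrib D.errors D.design P

section Disintegration

variable {E : Type*} [NormedAddCommGroup E]
  {F : ((Fin n → Fin p → ℝ) × (Fin n → Bool)) × (Fin n → ℝ) → E}

lemma integrable_map_design_errors (hF : StronglyMeasurable F)
    (hFi : Integrable (fun ω => F (D.design ω, D.errors ω)) P) :
    Integrable F (P.map fun ω => (D.design ω, D.errors ω)) :=
  (integrable_map_measure hF.aestronglyMeasurable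
    (D.measurable_design.prodMk D.measurable_errors).aemeasurable).2 hFi

variable [IsProbabilityMeasure P]

lemma integral_integral_errorKernel [NormedSpace ℝ E] (hF : StronglyMeasurable F)
    (hFi : Integrable (fun ω => F (D.design ω, D.errors ω)) P) :
    ∫ z, ∫ e, F (z, e) ∂(D.errorKernel P z) ∂(P.map D.design) =
      ∫ ω, F (D.design ω, D.errors ω) ∂P := by
  have hmap : (P.map D.design) ⊗ₘ D.errorKernel P = P.map fun ω => (D.design ω, D.errors ω) :=
    compProd_map_condDistrib D.measurable_errors.aemeasurable
  rw [← Measure.integral_compProd (hmap ▸ integrable_map_design_errors hF hFi), hmap,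
    integral_map (D.measurable_design.prodMk D.measurable_errors).aemeasurable
      hF.aestronglyMeasurable]

lemma norm_integral_sub_integral_le_of_ae_errorKernel [NormedSpace ℝ E]
    {G : (Fin n → Fin p → ℝ) × (Fin n → Bool) → E}
    {H : ((Fin n → Fin p → ℝ) × (Fin n → Bool)) × (Fin n → ℝ) → ℝ} (hF : StronglyMeasurable F)
    (hFi : Integrable (fun ω => F (D.design ω, D.errors ω)) P) (hG : StronglyMeasurable G)
    (hGi : Integrable (fun ω => G (D.design ω)) P) (hH : StronglyMeasurable H)
    (hHi : Integrable (fun ω => H (D.design ω, D.errors ω)) P)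
    (h : ∀ᵐ z ∂(P.map D.design), ‖∫ e, F (z, e) ∂(D.errorKernel P z) - G z‖ ≤
      ∫ e, H (z, e) ∂(D.errorKernel P z)) :
    ‖∫ ω, F (D.design ω, D.errors ω) ∂P - ∫ ω, G (D.design ω) ∂P‖ ≤
      ∫ ω, H (D.design ω, D.errors ω) ∂P := by
  have herr := D.measurable_errors.aemeasurable (μ := P)
  have hdes := D.measurable_design.aemeasurable (μ := P)
  rw [← integral_integral_errorKernel hF hFi, ← integral_integral_errorKernel hH hHi,
    ← integral_map hdes hG.aestronglyMeasurable, ← integral_sub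
      ((integrable_map_design_errors hF hFi).integral_condDistrib_map herr)
      ((integrable_map_measure hG.aestronglyMeasurable hdes).2 hGi)]
  exact norm_integral_le_of_norm_le
    ((integrable_map_design_errors hH hHi).integral_condDistrib_map herr) h

end Disintegration

variable [IsProbabilityMeasure P]

lemma ae_integral_errorKernel_eq {f : (Fin n → ℝ) → ℝ} (hf : Measurable f)
    (hfi : Integrable (fun ω => f (D.errors ω)) P) {c : ℝ}
    (h : P[fun ω => f (D.errors ω) | D.designSigma] =ᵐ[P] fun _ => c) :
    ∀ᵐ z ∂(P.map D.design), ∫ e, f e ∂(D.errorKernel P z) = c := by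
  have hm : StronglyMeasurable fun z => ∫ e, f e ∂(D.errorKernel P z) :=
    StronglyMeasurable.integral_condDistrib (f := fun x : _ × (Fin n → ℝ) => f x.2)
      (hf.comp measurable_snd).stronglyMeasurable
  rw [ae_map_iff D.measurable_design.aemeasurable
    (measurableSet_eq_fun hm.measurable measurable_const)]
  exact (condExp_ae_eq_integral_condDistrib D.measurable_design D.measurable_errors.aemeasurable
    hf.stronglyMeasurable hfi).symm.trans h

lemma Regular.ae_integral_error (h : D.Regular P q σ) :
    ∀ᵐ z ∂(P.map D.design), ∀ i, ∫ e, e i ∂(D.errorKernel P z) = 0 :=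
  ae_all_iff.2 fun i => ae_integral_errorKernel_eq (measurable_pi_apply i)
    (h.integrable_error i) (h.errors_exogenous i)

lemma Regular.ae_integral_error_sq (h : D.Regular P q σ) :
    ∀ᵐ z ∂(P.map D.design), ∀ i, ∫ e, e i ^ 2 ∂(D.errorKernel P z) = σ ^ 2 := by
  refine ae_all_iff.2 fun i => ae_integral_errorKernel_eq (f := fun e => e i ^ 2)
    ((measurable_pi_apply i).pow_const 2) (h.errors_memLp i).integrable_sq ?_
  filter_upwards [condVar_ae_eq_condExp_sq_sub_sq_condExp D.designSigma_le (h.errors_memLp i),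
    h.errors_homoscedastic i, h.errors_exogenous i] with ω hvar hσ hmean
  rw [hσ] at hvar
  simp only [Pi.sub_apply, Pi.pow_apply, hmean, ne_eq, OfNat.ofNat_ne_zero, not_false_eq_true,
    zero_pow, sub_zero] at hvar
  exact hvar.symm

lemma ae_memLp_error {i : Fin n} (h : MemLp (D.ε i) 3 P) :
    ∀ᵐ z ∂(P.map D.design), MemLp (fun e => e i) 3 (D.errorKernel P z) := by
  have hF : Measurable fun x : ((Fin n → Fin p → ℝ) × (Fin n → Bool)) × (Fin n → ℝ) =>
      ‖x.2 i‖ ^ 3 := by fun_prop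
  have hInt := integrable_map_design_errors (P := P) (D := D) hF.stronglyMeasurable
    (h.integrable_norm_pow three_ne_zero)
  filter_upwards [hInt.condDistrib_ae_map D.measurable_errors.aemeasurable] with z hz
  exact (integrable_norm_rpow_iff (measurable_pi_apply i).aestronglyMeasurable (by norm_num)
    (by norm_num)).1 (by simpa using hz)

lemma Regular.condExp_error_mul_error (h : D.Regular P q σ) {i j : Fin n} (hij : i ≠ j) :
    P[fun ω => D.ε i ω * D.ε j ω | D.designSigma] =ᵐ[P] 0 := by
  have hcond := condExp_ae_eq_integral_condDistrib (f := fun e => e i * e j) D.measurable_design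
    D.measurable_errors.aemeasurable
    ((measurable_pi_apply i).mul (measurable_pi_apply j)).stronglyMeasurable
    ((h.errors_memLp i).integrable_mul (h.errors_memLp j))
  filter_upwards [hcond, ae_of_ae_map D.measurable_design.aemeasurable h.errors_indep,
    ae_of_ae_map D.measurable_design.aemeasurable h.ae_integral_error] with ω hω hind hmean
  refine hω.trans ?_
  rw [(hind.indepFun hij).integral_fun_mul_eq_mul_integral
    (measurable_pi_apply i).aestronglyMeasurable (measurable_pi_apply j).aestronglyMeasurable,
    hmean i, zero_mul, Pi.zero_apply]

end ErrorKernel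

section CharacteristicFunction

variable [IsProbabilityMeasure P] {c : (Fin n → Fin p → ℝ) × (Fin n → Bool) → Fin n → ℝ} {b : ℝ}

lemma Regular.norm_integral_exp_sum_error_sub_le (h : D.Regular P q σ)
    (h3 : ∀ i, MemLp (D.ε i) 3 P) (hc : ∀ i, Measurable fun z => c z i)
    (hb : ∀ z i, |c z i| ≤ b) :
    ‖∫ ω, Complex.exp ((∑ i, c (D.design ω) i * D.ε i ω : ℝ) * Complex.I) ∂P -
        ∫ ω, ((Real.exp (-(σ ^ 2 / 2 * ∑ i, c (D.design ω) i ^ 2)) : ℝ) : ℂ) ∂P‖ ≤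
      ∑ i, 5 * b ^ 3 * ∫ ω, |D.ε i ω| ^ 3 ∂P := by
  have : ∀ i, Measurable fun x : ((Fin n → Fin p → ℝ) × (Fin n → Bool)) × (Fin n → ℝ) =>
      c x.1 i := fun i => (hc i).comp measurable_fst
  have hF : Measurable fun x : ((Fin n → Fin p → ℝ) × (Fin n → Bool)) × (Fin n → ℝ) =>
      Complex.exp ((∑ i, c x.1 i * x.2 i : ℝ) * Complex.I) := by fun_prop
  have hG : Measurable fun z => ((Real.exp (-(σ ^ 2 / 2 * ∑ i, c z i ^ 2)) : ℝ) : ℂ) := by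
    fun_prop
  have hH : Measurable fun x : ((Fin n → Fin p → ℝ) × (Fin n → Bool)) × (Fin n → ℝ) =>
      ∑ i, 5 * b ^ 3 * |x.2 i| ^ 3 := by fun_prop
  have hG_le : ∀ z, ‖((Real.exp (-(σ ^ 2 / 2 * ∑ i, c z i ^ 2)) : ℝ) : ℂ)‖ ≤ 1 := fun z => by
    rw [Complex.norm_real, Real.norm_eq_abs, Real.abs_exp, Real.exp_le_one_iff, neg_nonpos]
    positivity
  have hε : ∀ i, Integrable (fun ω => 5 * b ^ 3 * |D.ε i ω| ^ 3) P := fun i =>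
    ((h3 i).integrable_norm_pow three_ne_zero).const_mul _
  simp only [← integral_const_mul]
  rw [← integral_finsetSum _ fun i _ => hε i]
  refine norm_integral_sub_integral_le_of_ae_errorKernel hF.stronglyMeasurable
    (.of_bound (hF.comp (D.measurable_design.prodMk D.measurable_errors)).aestronglyMeasurable 1
      (ae_of_all _ fun ω => (Complex.norm_exp_ofReal_mul_I _).le))
    hG.stronglyMeasurable
    (.of_bound (hG.comp D.measurable_design).aestronglyMeasurable 1
      (ae_of_all _ fun ω => hG_le _))
    hH.stronglyMeasurable (integrable_finsetSum _ fun i _ => hε i) ?_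
  filter_upwards [h.ae_integral_error, h.ae_integral_error_sq,
    ae_all_iff.2 fun i => ae_memLp_error (h3 i), h.errors_indep] with z hmean hvar hL hind
  refine (norm_integral_exp_sum_sub_exp_le hind hL hmean hvar (c z)).trans ?_
  have hL' : ∀ i, Integrable (fun e : Fin n → ℝ => 5 * b ^ 3 * |e i| ^ 3) (D.errorKernel P z) :=
    fun i => ((hL i).integrable_norm_pow three_ne_zero).const_mul _
  rw [integral_finsetSum _ fun i _ => hL' i]
  simp only [integral_const_mul]
  gcongr with i
  exact hb z i

end CharacteristicFunction

section Orthogonality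

variable [IsProbabilityMeasure P]

lemma integrable_armInd (w : Bool) (i : Fin n) : Integrable (D.armInd w i) P :=
  .of_bound (D.measurable_armInd w i).aestronglyMeasurable 1 <| ae_of_all _ fun ω => by
    unfold armInd
    split_ifs <;> simp

lemma Regular.integral_armInd (h : D.Regular P q σ) (w : Bool) (i : Fin n) :
    ∫ ω, D.armInd w i ω ∂P = armProb q w := by
  have hind : D.armInd w i = {ω | D.W i ω = w}.indicator fun _ => 1 := by
    ext ω
    simp [armInd, Set.indicator_apply]
  have hmeas : MeasurableSet {ω | D.W i ω = w} := D.measurable_W i (measurableSet_singleton w)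
  rw [hind, integral_indicator_const _ hmeas, measureReal_def, h.measure_arm,
    ENNReal.toReal_ofReal (armProb_pos h.prob_pos h.prob_lt_one w).le, smul_eq_mul, mul_one]

lemma Regular.norm_armInd_sub_le (h : D.Regular P q σ) (w : Bool) (i : Fin n) (ω : Ω) :
    ‖D.armInd w i ω - armProb q w‖ ≤ 1 := by
  have h₀ := h.prob_pos
  have h₁ := h.prob_lt_one
  rw [Real.norm_eq_abs, abs_le]
  cases w <;> simp only [armInd, armProb] <;> split_ifs <;> constructor <;> linarith

lemma Regular.integral_armInd_sub_mul_armInd_sub (h : D.Regular P q σ) (w : Bool) {i j : Fin n}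
    (hij : i ≠ j) :
    ∫ ω, (D.armInd w i ω - armProb q w) * (D.armInd w j ω - armProb q w) ∂P = 0 := by
  have hmeas : Measurable fun b : Bool => (if b = w then (1 : ℝ) else 0) - armProb q w :=
    measurable_of_countable _
  have hmean : ∫ ω, (D.armInd w i ω - armProb q w) ∂P = 0 := by
    rw [integral_sub (integrable_armInd w i) (integrable_const _), h.integral_armInd]
    simp
  exact ((h.treatments_indep.indepFun hij).integral_fun_comp_mul_comp
    (D.measurable_W i).aemeasurable (D.measurable_W j).aemeasurable
    hmeas.aestronglyMeasurable hmeas.aestronglyMeasurable).trans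
    (mul_eq_zero_of_left hmean _)

lemma Regular.integral_armInd_sub_mul_of_indepFun (h : D.Regular P q σ)
    (hind : IndepFun D.features D.treatments P) (w : Bool) {i j : Fin n} (hij : i ≠ j)
    {g g' : (Fin n → Fin p → ℝ) → ℝ} (hg : Measurable g) (hg' : Measurable g') :
    ∫ ω, (D.armInd w i ω - armProb q w) * g (D.features ω) *
      ((D.armInd w j ω - armProb q w) * g' (D.features ω)) ∂P = 0 := by
  have hmeas : Measurable fun b : Fin n → Bool => ((if b i = w then (1 : ℝ) else 0) - armProb q w) *
      ((if b j = w then (1 : ℝ) else 0) - armProb q w) := measurable_of_countable _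
  have hprod := hind.symm.integral_fun_comp_mul_comp measurable_treatments.aemeasurable
    measurable_features.aemeasurable hmeas.aestronglyMeasurable (hg.mul hg').aestronglyMeasurable
  refine (integral_congr_ae (ae_of_all _ fun ω => mul_mul_mul_comm _ _ _ _)).trans ?_
  exact hprod.trans (mul_eq_zero_of_left (h.integral_armInd_sub_mul_armInd_sub w hij) _)

lemma Regular.integral_score_summand_mul_score_summand (h : D.Regular P q σ)
    (hC : D.FourthMomentsLE P C) (w : Bool) (k : Fin (p + 1)) {i j : Fin n} (hij : i ≠ j) :
    ∫ ω, D.armInd w i ω * (D.regressor i ω k * D.ε i ω) *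
      (D.armInd w j ω * (D.regressor j ω k * D.ε j ω)) ∂P = 0 := by
  have hcoef : ∀ i, Measurable[D.designSigma] fun ω => D.armInd w i ω * D.regressor i ω k :=
    fun i => (D.measurable_armInd_designSigma w i).mul (D.measurable_regressor_designSigma i k)
  have hL2 : ∀ i, MemLp (fun ω => D.armInd w i ω * (D.regressor i ω k * D.ε i ω)) 2 P :=
    fun i => hC.memLp_score_summand w i k
  have hrearrange : ∀ ω, D.armInd w i ω * (D.regressor i ω k * D.ε i ω) *
      (D.armInd w j ω * (D.regressor j ω k * D.ε j ω)) =
      D.armInd w i ω * D.regressor i ω k * (D.armInd w j ω * D.regressor j ω k) *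
        (D.ε i ω * D.ε j ω) := fun ω => by ring
  have hInt := (hL2 i).integrable_mul (hL2 j)
  simp only [Pi.mul_def, hrearrange] at hInt ⊢
  exact integral_mul_eq_zero_of_condExp_eq_zero D.designSigma_le
    ((hcoef i).mul (hcoef j)).stronglyMeasurable
    ((h.errors_memLp i).integrable_mul (h.errors_memLp j)) hInt (h.condExp_error_mul_error hij)

lemma Regular.eLpNorm_inv_sqrt_mul_score_le (h : D.Regular P q σ) (hC : D.FourthMomentsLE P C)
    (w : Bool) (k : Fin (p + 1)) :
    eLpNorm (fun ω => (√(n : ℝ))⁻¹ * D.score w ω k) 2 P ≤ max 1 C * max 1 C := by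
  simpa only [Fintype.card_fin, score] using eLpNorm_inv_sqrt_mul_sum_le_of_orthogonal
    (fun i => hC.memLp_score_summand w i k)
    (fun i j hij => h.integral_score_summand_mul_score_summand hC w k hij)
    fun i => hC.eLpNorm_score_summand_le w i k

end Orthogonality

end Experiment

section Slutsky

variable {Ω : ℕ → Type*} [∀ n, MeasurableSpace (Ω n)] {P : ∀ n, Measure (Ω n)}
  [∀ n, IsProbabilityMeasure (P n)]

lemma tendstoInDistribution_of_tendsto_dist_whp {E Ω' : Type*} [MeasurableSpace Ω']
    [PseudoMetricSpace E] [MeasurableSpace E] [OpensMeasurableSpace E] {μ : Measure Ω'}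
    [IsProbabilityMeasure μ] {S T : ∀ n, Ω n → E} {Z : Ω' → E}
    (hT : TendstoInDistribution T atTop Z P μ) (hS : ∀ n, AEMeasurable (S n) (P n))
    (hST : Tendsto (fun x : Σ n, Ω n => dist (S x.1 x.2) (T x.1 x.2)) (whp P) (𝓝 0)) :
    TendstoInDistribution S atTop Z P μ := by
  refine ⟨hS, hT.aemeasurable_limit, ?_⟩
  refine tendsto_iff_forall_lipschitz_integral_tendsto.2 fun F ⟨M, hM⟩ ⟨L, hL⟩ => ?_
  have hF : Measurable F := hL.continuous.measurable
  have hlimT := tendsto_iff_forall_lipschitz_integral_tendsto.1 hT.tendsto F ⟨M, hM⟩ ⟨L, hL⟩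
  simp only [ProbabilityMeasure.coe_mk, integral_map (hT.forall_aemeasurable _)
    hF.aestronglyMeasurable, integral_map (hS _) hF.aestronglyMeasurable] at hlimT ⊢
  have hInt : ∀ {n} {U : Ω n → E}, AEMeasurable U (P n) → Integrable (fun ω => F (U ω)) (P n) := by
    intro n U hU
    obtain ⟨ω₀⟩ : Nonempty (Ω n) := (P n).nonempty_of_neZero
    refine .of_bound (hF.comp_aemeasurable hU).aestronglyMeasurable (‖F (U ω₀)‖ + M)
      (ae_of_all _ fun ω => ?_)
    exact (norm_le_norm_add_norm_sub' _ _).trans (by gcongr; exact hM _ _)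
  have hdiff : Tendsto (fun x : Σ n, Ω n => F (S x.1 x.2) - F (T x.1 x.2)) (whp P) (𝓝 0) :=
    squeeze_zero_norm (fun x => (Real.dist_eq _ _).symm.trans_le (hL.dist_le_mul _ _))
      (by simpa using hST.const_mul (L : ℝ))
  have hbound : ∀ n, eLpNorm (fun ω => F (S n ω) - F (T n ω)) 2 (P n) ≤ ENNReal.ofReal M := fun n =>
    (eLpNorm_le_of_ae_bound (C := M) <| ae_of_all _ fun ω =>
      (Real.dist_eq _ _).symm.trans_le (hM (S n ω) (T n ω))).trans (by simp)
  have hzero : Tendsto (fun n => ∫ ω, F (S n ω) - F (T n ω) ∂(P n)) atTop (𝓝 0) :=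
    tendsto_integral_of_tendsto_whp (Z := fun n ω => F (S n ω) - F (T n ω)) hdiff
      (fun n => ((hInt (hS n)).sub (hInt (hT.forall_aemeasurable n))).1) hbound
      ENNReal.ofReal_ne_top
  simpa [integral_sub (hInt (hS _)) (hInt (hT.forall_aemeasurable _))] using hzero.add hlimT

lemma tendsto_integral_exp_neg_of_tendsto_whp {V : ∀ n, Ω n → ℝ} {a v : ℝ}
    (hv : Tendsto (fun x : Σ n, Ω n => V x.1 x.2) (whp P) (𝓝 v)) (hV : ∀ n, Measurable (V n))
    (hV₀ : ∀ n ω, 0 ≤ V n ω) (ha : 0 ≤ a) :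
    Tendsto (fun n => ∫ ω, ((Real.exp (-(a * V n ω)) : ℝ) : ℂ) ∂(P n)) atTop
      (𝓝 ((Real.exp (-(a * v)) : ℝ) : ℂ)) := by
  have hcont : Continuous fun v => ((Real.exp (-(a * v)) : ℝ) : ℂ) := by fun_prop
  refine tendsto_integral_of_tendsto_whp (M := 1) ((hcont.tendsto v).comp hv)
    (fun n => (hcont.measurable.comp (hV n)).aestronglyMeasurable) (fun n => ?_) ENNReal.one_ne_top
  refine (eLpNorm_le_of_ae_bound (C := 1) (ae_of_all _ fun ω => ?_)).trans (by simp)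
  rw [Complex.norm_real, Real.norm_of_nonneg (Real.exp_pos _).le, Real.exp_le_one_iff, neg_nonpos]
  exact mul_nonneg ha (hV₀ n ω)

end Slutsky

section ErrorCLT

namespace Experiment

section FixedSize

variable {n p : ℕ} {Ω : Type*} [MeasurableSpace Ω] {D : Experiment n p Ω} {P : Measure Ω}
  [IsProbabilityMeasure P] {q σ : ℝ} {B C : ℝ≥0}
  {c : (Fin n → Fin p → ℝ) × (Fin n → Bool) → Fin n → ℝ}

lemma FourthMomentsLE.eLpNorm_three_error_le (h : D.FourthMomentsLE P C) (i : Fin n) :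
    eLpNorm (D.ε i) 3 P ≤ max 1 C :=
  (eLpNorm_le_eLpNorm_of_exponent_le (by norm_num)
    (D.measurable_ε i).aestronglyMeasurable).trans (h.eLpNorm_error_le i)

lemma FourthMomentsLE.memLp_three_error (h : D.FourthMomentsLE P C) (i : Fin n) :
    MemLp (D.ε i) 3 P :=
  ⟨(D.measurable_ε i).aestronglyMeasurable,
    (h.eLpNorm_three_error_le i).trans_lt (by finiteness)⟩

lemma FourthMomentsLE.integral_abs_error_pow_three_le (h : D.FourthMomentsLE P C) (i : Fin n) :
    ∫ ω, |D.ε i ω| ^ 3 ∂P ≤ max 1 (C : ℝ) ^ 3 := by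
  have hpow : ∫⁻ ω, ‖D.ε i ω‖ₑ ^ 3 ∂P = eLpNorm (D.ε i) 3 P ^ 3 := by
    simpa using (eLpNorm_nnreal_pow_eq_lintegral (f := D.ε i) (p := 3) (μ := P)
      three_ne_zero).symm
  rw [← ENNReal.ofReal_le_ofReal_iff (by positivity)]
  calc ENNReal.ofReal (∫ ω, |D.ε i ω| ^ 3 ∂P) = ∫⁻ ω, ‖D.ε i ω‖ₑ ^ 3 ∂P := by
        rw [ofReal_integral_eq_lintegral_ofReal
          (by simpa only [Real.norm_eq_abs] using
            (h.memLp_three_error i).integrable_norm_pow three_ne_zero)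
          (ae_of_all _ fun ω => by positivity)]
        simp [Real.enorm_eq_ofReal_abs, ENNReal.ofReal_pow]
    _ ≤ (max 1 (C : ℝ≥0∞)) ^ 3 := by
        rw [hpow]
        gcongr
        exact h.eLpNorm_three_error_le i
    _ = ENNReal.ofReal (max 1 (C : ℝ) ^ 3) := by
        rw [ENNReal.ofReal_pow (by positivity), ENNReal.ofReal_max]
        simp

lemma Regular.norm_charFun_map_sub_le (h : D.Regular P q σ) (hC : D.FourthMomentsLE P C)
    (hc : ∀ i, Measurable fun z => c z i) (hB : ∀ z i, |c z i| ≤ B) (t : ℝ) :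
    ‖charFun (P.map fun ω => (√(n : ℝ))⁻¹ * ∑ i, c (D.design ω) i * D.ε i ω) t -
        ∫ ω, ((Real.exp (-(t ^ 2 / 2 *
          (σ ^ 2 * ((1 / (n : ℝ)) * ∑ i, c (D.design ω) i ^ 2)))) : ℝ) : ℂ) ∂P‖ ≤
      5 * (|t| * B * max 1 C) ^ 3 * (√(n : ℝ))⁻¹ := by
  set r := (√(n : ℝ))⁻¹
  have hr : r ^ 2 = 1 / (n : ℝ) := by
    rw [inv_pow, Real.sq_sqrt n.cast_nonneg, one_div]
  have hb : ∀ z i, |t * (r * c z i)| ≤ |t| * (r * B) := fun z i => by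
    rw [abs_mul, abs_mul, abs_of_nonneg (by positivity : 0 ≤ r)]
    gcongr
    exact hB z i
  have hbound := h.norm_integral_exp_sum_error_sub_le hC.memLp_three_error
    (fun i => ((hc i).const_mul r).const_mul t) hb
  have hcoef : ∀ z, σ ^ 2 / 2 * ∑ i, (t * (r * c z i)) ^ 2 =
      t ^ 2 / 2 * (σ ^ 2 * ((1 / (n : ℝ)) * ∑ i, c z i ^ 2)) := fun z => by
    simp only [mul_pow, ← Finset.mul_sum, hr]
    ring
  have hexp : charFun (P.map fun ω => r * ∑ i, c (D.design ω) i * D.ε i ω) t =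
      ∫ ω, Complex.exp ((∑ i, t * (r * c (D.design ω) i) * D.ε i ω : ℝ) * Complex.I) ∂P := by
    have := D.measurable_design
    have := D.measurable_ε
    rw [charFun_apply_real, integral_map (by fun_prop) (by fun_prop)]
    simp [Finset.mul_sum, mul_assoc]
  simp only [hcoef, ← hexp] at hbound
  have hrate : n * r ^ 3 = r := by
    rw [pow_succ, hr, ← mul_assoc]
    rcases n.eq_zero_or_pos with rfl | hn
    · simp [r]
    · field_simp
  calc _ ≤ _ := hbound
    _ ≤ ∑ _i : Fin n, 5 * (|t| * (r * B)) ^ 3 * max 1 (C : ℝ) ^ 3 := by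
        gcongr with i
        exact hC.integral_abs_error_pow_three_le i
    _ = 5 * (|t| * B * max 1 C) ^ 3 * (n * r ^ 3) := by simp; ring
    _ = _ := by rw [hrate]

end FixedSize

variable {p : ℕ} {Ω : ℕ → Type*} [∀ n, MeasurableSpace (Ω n)] {P : ∀ n, Measure (Ω n)}
  [∀ n, IsProbabilityMeasure (P n)] {D : ∀ n, Experiment n p (Ω n)} {q σ : ℕ → ℝ} {B C s : ℝ≥0}
  {c : ∀ n, (Fin n → Fin p → ℝ) × (Fin n → Bool) → Fin n → ℝ}

lemma tendstoInDistribution_sum_mul_error (hreg : ∀ n, (D n).Regular (P n) (q n) (σ n))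
    (hmom : ∀ n, (D n).FourthMomentsLE (P n) C) (hc : ∀ n i, Measurable fun z => c n z i)
    (hB : ∀ n z i, |c n z i| ≤ B)
    (hs : Tendsto (fun x : Σ n, Ω n =>
      σ x.1 ^ 2 * ((1 / (x.1 : ℝ)) * ∑ i, c x.1 ((D x.1).design x.2) i ^ 2)) (whp P) (𝓝 (s : ℝ))) :
    TendstoInDistribution
      (fun (n : ℕ) ω => (√(n : ℝ))⁻¹ * ∑ i, c n ((D n).design ω) i * (D n).ε i ω) atTop id P
      (gaussianReal 0 s) where
  forall_aemeasurable n := by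
    have := (D n).measurable_design
    have := (D n).measurable_ε
    fun_prop
  tendsto := by
    refine ProbabilityMeasure.tendsto_iff_tendsto_charFun.2 fun t => ?_
    simp only [ProbabilityMeasure.coe_mk, Measure.map_id]
    have hmain : Tendsto (fun n => ∫ ω, ((Real.exp (-(t ^ 2 / 2 * (σ n ^ 2 * ((1 / (n : ℝ)) *
        ∑ i, c n ((D n).design ω) i ^ 2)))) : ℝ) : ℂ) ∂(P n)) atTop
        (𝓝 ((Real.exp (-(t ^ 2 / 2 * s)) : ℝ) : ℂ)) := by
      refine tendsto_integral_exp_neg_of_tendsto_whp hs (fun n => ?_) (fun n ω => by positivity)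
        (by positivity)
      have hcn := hc n
      have hdesign := (D n).measurable_design
      fun_prop
    have hrate : Tendsto (fun n : ℕ => 5 * (|t| * B * max 1 C) ^ 3 * (√(n : ℝ))⁻¹) atTop (𝓝 0) := by
      simpa using (tendsto_inv_atTop_zero.comp
        (Real.tendsto_sqrt_atTop.comp tendsto_natCast_atTop_atTop)).const_mul
        (5 * (|t| * B * max 1 C : ℝ) ^ 3)
    have hdiff := squeeze_zero_norm
      (fun n => (hreg n).norm_charFun_map_sub_le (hmom n) (hc n) (hB n) t) hrate
    have hlimit : charFun (gaussianReal 0 s) t = ((Real.exp (-(t ^ 2 / 2 * s)) : ℝ) : ℂ) := by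
      rw [charFun_gaussianReal]
      push_cast
      ring_nf
    rw [hlimit]
    simpa using hdiff.add hmain

end Experiment

end ErrorCLT

section InverseProbabilityWeights

/-- The inverse probability weight of a unit in arm `w`, with the sign of the arm in the treatment
contrast. -/
noncomputable def ipwWeight (q : ℝ) (w : Bool) : ℝ :=
  if w then (armProb q true)⁻¹ else -(armProb q false)⁻¹

lemma abs_ipwWeight_le (q : ℝ) (w : Bool) :
    |ipwWeight q w| ≤ |(armProb q true)⁻¹| + |(armProb q false)⁻¹| := by
  cases w <;> simp [ipwWeight]

namespace Experiment

variable {n p : ℕ} {Ω : Type*} [MeasurableSpace Ω] (D : Experiment n p Ω) (q : ℝ)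

lemma ipwWeight_eq (i : Fin n) (ω : Ω) :
    ipwWeight q (D.W i ω) =
      (armProb q true)⁻¹ * D.armInd true i ω - (armProb q false)⁻¹ * D.armInd false i ω := by
  cases h : D.W i ω <;> simp [ipwWeight, armInd, h]

lemma ipwWeight_sq (i : Fin n) (ω : Ω) :
    ipwWeight q (D.W i ω) ^ 2 =
      (armProb q true)⁻¹ ^ 2 * D.armInd true i ω +
        (armProb q false)⁻¹ ^ 2 * D.armInd false i ω := by
  cases h : D.W i ω <;> simp [ipwWeight, armInd, h]

lemma inv_sqrt_mul_sum_ipwWeight_mul_error (ω : Ω) :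
    (√(n : ℝ))⁻¹ * ∑ i, ipwWeight q (D.W i ω) * D.ε i ω =
      (armProb q true)⁻¹ * ((√(n : ℝ))⁻¹ * D.score true ω 0) -
        (armProb q false)⁻¹ * ((√(n : ℝ))⁻¹ * D.score false ω 0) := by
  simp only [ipwWeight_eq, score, regressor, Matrix.cons_val_zero, one_mul, sub_mul,
    Finset.sum_sub_distrib, mul_assoc, ← Finset.mul_sum]
  ring

end Experiment

end InverseProbabilityWeights

section Limits

namespace Experiment

variable {p : ℕ} {Ω : ℕ → Type*} [∀ n, MeasurableSpace (Ω n)] {P : ∀ n, Measure (Ω n)}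
  {D : ∀ n, Experiment n p (Ω n)} {q σ : ℕ → ℝ} {q₀ σ₀ : ℝ}
  {muX : Fin p → ℝ} {SigmaX : Matrix (Fin p) (Fin p) ℝ} {C : ℝ≥0}

lemma tendsto_whp_average_ipwWeight_sq (hq₀ : 0 < q₀) (hq₀' : q₀ < 1)
    (hG : ∀ w, Tendsto (fun x : Σ n, Ω n => (x.1 : ℝ)⁻¹ • (D x.1).gram w x.2) (whp P)
      (𝓝 (armProb q₀ w • momentMatrix muX SigmaX))) :
    Tendsto (fun x : Σ n, Ω n =>
      (1 / (x.1 : ℝ)) * ∑ i, ipwWeight q₀ ((D x.1).W i x.2) ^ 2) (whp P)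
      (𝓝 (1 / (q₀ * (1 - q₀)))) := by
  have hcorner : ∀ w, Tendsto (fun x : Σ n, Ω n => (1 / (x.1 : ℝ)) * ∑ i, (D x.1).armInd w i x.2)
      (whp P) (𝓝 (armProb q₀ w)) := fun w => by
    simpa [gram, regressor, momentMatrix, borderZero] using
      tendsto_pi_nhds.1 (tendsto_pi_nhds.1 (hG w) 0) 0
  have hlim : (armProb q₀ true)⁻¹ ^ 2 * armProb q₀ true +
      (armProb q₀ false)⁻¹ ^ 2 * armProb q₀ false = 1 / (q₀ * (1 - q₀)) := by
    have : 1 - q₀ ≠ 0 := by linarith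
    simp only [armProb, if_true, Bool.false_eq_true, if_false]
    field_simp
    ring
  rw [← hlim]
  refine (((hcorner true).const_mul _).add ((hcorner false).const_mul _)).congr fun x => ?_
  simp only [ipwWeight_sq, Finset.sum_add_distrib, ← Finset.mul_sum]
  ring

variable [∀ n, IsProbabilityMeasure (P n)]

lemma tendsto_whp_average_armInd_sub_mul (hreg : ∀ n, (D n).Regular (P n) (q n) (σ n))
    (hmom : ∀ n, (D n).FourthMomentsLE (P n) C)
    (hind : ∀ n, IndepFun (D n).features (D n).treatments (P n)) (w : Bool) (k l : Fin (p + 1)) :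
    Tendsto (fun x : Σ n, Ω n => (1 / (x.1 : ℝ)) * ∑ i,
      ((D x.1).armInd w i x.2 - armProb (q x.1) w) *
        ((D x.1).regressor i x.2 k * (D x.1).regressor i x.2 l)) (whp P) (𝓝 0) := by
  have hmeas : ∀ n (i : Fin n), Measurable fun x : Fin n → Fin p → ℝ =>
      (Matrix.vecCons 1 (x i) k : ℝ) * Matrix.vecCons 1 (x i) l := fun n i =>
    ((measurable_vecCons k).comp (measurable_pi_apply i)).mul
      ((measurable_vecCons l).comp (measurable_pi_apply i))
  refine tendsto_whp_average_of_orthogonal (M := max 1 C * max 1 C) (by finiteness)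
    (f := fun n i ω => ((D n).armInd w i ω - armProb (q n) w) *
      ((D n).regressor i ω k * (D n).regressor i ω l))
    (fun n i => ?_) (fun n i => ?_) fun n i j hij =>
      (hreg n).integral_armInd_sub_mul_of_indepFun (hind n) w hij (hmeas n i) (hmeas n j)
  · exact ((((D n).measurable_armInd w i).sub_const _).mul
      (((D n).measurable_regressor i k).mul ((D n).measurable_regressor i l))).aestronglyMeasurable
  · refine (eLpNorm_mono fun ω => ?_).trans ((hmom n).eLpNorm_regressor_mul_regressor_le i k l)
    rw [norm_mul]
    exact mul_le_of_le_one_left (norm_nonneg _) ((hreg n).norm_armInd_sub_le w i ω)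

lemma tendsto_whp_inv_smul_gram (hreg : ∀ n, (D n).Regular (P n) (q n) (σ n))
    (hmom : ∀ n, (D n).FourthMomentsLE (P n) C)
    (hind : ∀ n, IndepFun (D n).features (D n).treatments (P n)) (hq : Tendsto q atTop (𝓝 q₀))
    (hmean : ∀ k, TendstoInProb P (fun n ω => (D n).xbar ω k) (muX k))
    (hcov : ∀ k l, TendstoInProb P (fun n ω => (D n).sampleCov ω k l) (SigmaX k l)) (w : Bool) :
    Tendsto (fun x : Σ n, Ω n => (x.1 : ℝ)⁻¹ • (D x.1).gram w x.2) (whp P)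
      (𝓝 (armProb q₀ w • momentMatrix muX SigmaX)) := by
  have hxbar : Tendsto (fun x : Σ n, Ω n => (D x.1).xbar x.2) (whp P) (𝓝 muX) :=
    tendsto_pi_nhds.2 fun k => (hmean k).tendsto_whp
  have hsampleCov : Tendsto (fun x : Σ n, Ω n => (D x.1).sampleCov x.2) (whp P) (𝓝 SigmaX) :=
    tendsto_pi_nhds.2 fun k => tendsto_pi_nhds.2 fun l => (hcov k l).tendsto_whp
  have hmoment := (continuous_momentMatrix.tendsto (muX, SigmaX)).comp
    (hxbar.prodMk_nhds hsampleCov)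
  have hprob := ((continuous_armProb w).tendsto q₀).comp (hq.comp (tendsto_fst_whp (P := P)))
  refine tendsto_pi_nhds.2 fun k => tendsto_pi_nhds.2 fun l => ?_
  have hfluct := tendsto_whp_average_armInd_sub_mul hreg hmom hind w k l
  have hsum := (hprob.mul (tendsto_pi_nhds.1 (tendsto_pi_nhds.1 hmoment k) l)).add hfluct
  rw [add_zero] at hsum
  refine hsum.congr' ?_
  filter_upwards [tendsto_fst_whp.eventually (eventually_ne_atTop 0)] with x hx
  simp only [Function.comp_apply, Matrix.smul_apply, smul_eq_mul]
  rw [← (D x.1).average_regressor_mul_regressor hx x.2 k l]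
  simp only [gram, Matrix.of_apply, sub_mul, Finset.sum_sub_distrib, ← Finset.mul_sum]
  ring

lemma tendsto_whp_sqrt_mul_betaHat_sub (hreg : ∀ n, (D n).Regular (P n) (q n) (σ n))
    (hmom : ∀ n, (D n).FourthMomentsLE (P n) C) {w : Bool} {a : ℝ} (ha : a ≠ 0)
    (hSigma : SigmaX.PosDef)
    (hG : Tendsto (fun x : Σ n, Ω n => (x.1 : ℝ)⁻¹ • (D x.1).gram w x.2) (whp P)
      (𝓝 (a • momentMatrix muX SigmaX)))
    {u : ℕ → Fin p → ℝ} (hu : Tendsto u atTop (𝓝 muX)) :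
    Tendsto (fun x : Σ n, Ω n =>
      √(x.1 : ℝ) * (Matrix.vecCons 1 (u x.1) ⬝ᵥ ((D x.1).betaHat w x.2 - (D x.1).beta w)) -
        a⁻¹ * ((√(x.1 : ℝ))⁻¹ * (D x.1).score w x.2 0)) (whp P) (𝓝 0) := by
  set v : (Σ n, Ω n) → Fin (p + 1) → ℝ := fun x =>
    Matrix.vecCons 1 (u x.1) ᵥ* ((x.1 : ℝ)⁻¹ • (D x.1).gram w x.2)⁻¹ - Pi.single 0 a⁻¹
  have hv : Tendsto v (whp P) (𝓝 0) := by
    simpa using (tendsto_vecMul_inv ha hSigma (hu.comp tendsto_fst_whp) hG).sub_const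
      (Pi.single 0 a⁻¹)
  have hsum : Tendsto (fun x : Σ n, Ω n => v x ⬝ᵥ (√(x.1 : ℝ))⁻¹ • (D x.1).score w x.2)
      (whp P) (𝓝 0) := by
    simpa only [dotProduct, Pi.smul_apply, smul_eq_mul, Finset.sum_const_zero] using
      tendsto_finsetSum Finset.univ fun k _ => tendsto_whp_zero_mul_of_eLpNorm_le
      (tendsto_pi_nhds.1 hv k) two_ne_zero ENNReal.ofNat_ne_top
      (fun n => (((D n).measurable_score w k).const_mul _).aestronglyMeasurable)
      (fun n => (hreg n).eLpNorm_inv_sqrt_mul_score_le (hmom n) w k) (by finiteness)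
  refine hsum.congr' ?_
  filter_upwards [eventually_isUnit_det_of_tendsto ha hSigma hG] with x hx
  have hdet : IsUnit ((D x.1).gram w x.2).det := by
    rw [Matrix.det_smul] at hx
    exact isUnit_of_mul_isUnit_right hx
  rw [(D x.1).betaHat_eq_beta_add hdet, add_sub_cancel_left,
    sqrt_mul_dotProduct_inv_mulVec _ _ _ hdet, sub_dotProduct, single_dotProduct,
    Pi.smul_apply, smul_eq_mul]

lemma tendstoInDistribution_sum_ipwWeight_mul_error
    (hreg : ∀ n, (D n).Regular (P n) (q n) (σ n)) (hmom : ∀ n, (D n).FourthMomentsLE (P n) C)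
    (hq₀ : 0 < q₀) (hq₀' : q₀ < 1) (hσ : Tendsto (fun n => σ n ^ 2) atTop (𝓝 (σ₀ ^ 2)))
    (hG : ∀ w, Tendsto (fun x : Σ n, Ω n => (x.1 : ℝ)⁻¹ • (D x.1).gram w x.2) (whp P)
      (𝓝 (armProb q₀ w • momentMatrix muX SigmaX))) :
    TendstoInDistribution
      (fun (n : ℕ) ω => (√(n : ℝ))⁻¹ * ∑ i, ipwWeight q₀ ((D n).W i ω) * (D n).ε i ω) atTop
      id P (gaussianReal 0 (Real.toNNReal (σ₀ ^ 2 / (q₀ * (1 - q₀))))) := by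
  refine tendstoInDistribution_sum_mul_error hreg hmom
    (c := fun n z i => ipwWeight q₀ (z.2 i))
    (B := ⟨|(armProb q₀ true)⁻¹| + |(armProb q₀ false)⁻¹|, by positivity⟩)
    (fun n i => (measurable_of_finite (ipwWeight q₀)).comp
      ((measurable_pi_apply i).comp measurable_snd))
    (fun n z i => abs_ipwWeight_le q₀ (z.2 i)) ?_
  have hvar : 0 ≤ σ₀ ^ 2 / (q₀ * (1 - q₀)) :=
    div_nonneg (sq_nonneg _) (mul_pos hq₀ (sub_pos.2 hq₀')).le
  rw [Real.coe_toNNReal _ hvar, ← mul_one_div]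
  exact (hσ.comp tendsto_fst_whp).mul (tendsto_whp_average_ipwWeight_sq hq₀ hq₀' hG)

lemma tendsto_whp_sqrt_mul_tauHat_sub_gate (hreg : ∀ n, (D n).Regular (P n) (q n) (σ n))
    (hmom : ∀ n, (D n).FourthMomentsLE (P n) C)
    (hind : ∀ n, IndepFun (D n).features (D n).treatments (P n))
    (homega : ∀ n w k, (D n).omega (P n) w k = ∫ ω, (D n).xbar ω k ∂(P n))
    (hlim : ∀ w, Tendsto (fun n => (D n).omega (P n) w) atTop (𝓝 muX))
    (hq₀ : 0 < q₀) (hq₀' : q₀ < 1) (hSigma : SigmaX.PosDef)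
    (hG : ∀ w, Tendsto (fun x : Σ n, Ω n => (x.1 : ℝ)⁻¹ • (D x.1).gram w x.2) (whp P)
      (𝓝 (armProb q₀ w • momentMatrix muX SigmaX))) :
    Tendsto (fun x : Σ n, Ω n =>
      √(x.1 : ℝ) * ((D x.1).tauHat (P x.1) x.2 - (D x.1).gate (P x.1)) -
        (√(x.1 : ℝ))⁻¹ * ∑ i, ipwWeight q₀ ((D x.1).W i x.2) * (D x.1).ε i x.2)
      (whp P) (𝓝 0) := by
  have harm := fun w => tendsto_whp_sqrt_mul_betaHat_sub hreg hmom
    (armProb_pos hq₀ hq₀' w).ne' hSigma (hG w) (hlim w)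
  have hdiff := (harm true).sub (harm false)
  rw [sub_zero] at hdiff
  refine hdiff.congr' ?_
  filter_upwards [tendsto_fst_whp.eventually (eventually_ne_atTop 0)] with x hx
  have hgate : (D x.1).gate (P x.1) =
      Matrix.vecCons 1 ((D x.1).omega (P x.1) true) ⬝ᵥ (D x.1).beta true -
        Matrix.vecCons 1 ((D x.1).omega (P x.1) false) ⬝ᵥ (D x.1).beta false := by
    rw [(hreg x.1).gate_eq (hmom x.1) (hind x.1) hx, surface_eq_dotProduct, surface_eq_dotProduct,
      funext (homega x.1 true), funext (homega x.1 false)]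
  rw [inv_sqrt_mul_sum_ipwWeight_mul_error, hgate, tauHat, dotProduct_sub, dotProduct_sub]
  ring

lemma tendsto_omega (hmom : ∀ n, (D n).FourthMomentsLE (P n) C)
    (hmean : ∀ k, TendstoInProb P (fun n ω => (D n).xbar ω k) (muX k))
    (homega : ∀ n w k, (D n).omega (P n) w k = ∫ ω, (D n).xbar ω k ∂(P n)) (w : Bool) :
    Tendsto (fun n => (D n).omega (P n) w) atTop (𝓝 muX) := by
  refine tendsto_pi_nhds.2 fun k => ?_
  simp only [homega]
  exact tendsto_integral_of_tendsto_whp (hmean k).tendsto_whp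
    (fun n => ((D n).measurable_xbar k).aestronglyMeasurable)
    (fun n => (hmom n).eLpNorm_xbar_le k) (by finiteness)

end Experiment

end Limits

theorem corollary1 {p : ℕ} {Ω : ℕ → Type*} [∀ n, MeasurableSpace (Ω n)]
    (P : ∀ n, Measure (Ω n)) [∀ n, IsProbabilityMeasure (P n)]
    (D : ∀ n, Experiment n p (Ω n))
    (q σ : ℕ → ℝ) (q₀ σ₀ : ℝ)
    (hreg : ∀ n, (D n).Regular (P n) (q n) (σ n))
    -- limits of the parameters
    (hq₀ : 0 < q₀) (hq₀' : q₀ < 1)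
    (hq : Tendsto q atTop (𝓝 q₀))
    (hσ : Tendsto (fun n => σ n ^ 2) atTop (𝓝 (σ₀ ^ 2)))
    -- convergence of the sample moments
    (muX : Fin p → ℝ) (SigmaX : Matrix (Fin p) (Fin p) ℝ) (hSigma : SigmaX.PosDef)
    (hmean : ∀ k, TendstoInProb P (fun n ω => (D n).xbar ω k) (muX k))
    (hcov : ∀ k l, TendstoInProb P (fun n ω => (D n).sampleCov ω k l) (SigmaX k l))
    -- bounded fourth moments
    (hmom : ∃ C : ℝ≥0, ∀ n, (D n).FourthMomentsLE (P n) C)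
    -- either the features are functions of the indirect treatments, or else (random features)
    -- the feature array is independent of the treatment vector
    (hfeat : ∀ n, (D n).FeaturesOfIndirect (P n) ∨
      IndepFun (D n).features (D n).treatments (P n))
    -- the features are static
    (hstatic : ∀ n i, IndepFun ((D n).X i) ((D n).indirect i) (P n)) :
    (∀ n w k, (D n).omega (P n) w k = ∫ ω, (D n).xbar ω k ∂(P n)) ∧
    (∀ w, Tendsto (fun n => (D n).omega (P n) w) atTop (𝓝 muX)) ∧
    TendstoInDistribution
      (fun (n : ℕ) ω => √(n : ℝ) * ((D n).tauHat (P n) ω - (D n).gate (P n))) atTop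
      id P (gaussianReal 0 (Real.toNNReal (σ₀ ^ 2 / (q₀ * (1 - q₀))))) := by
  obtain ⟨C, hmom⟩ := hmom
  have hind : ∀ n, IndepFun (D n).features (D n).treatments (P n) := fun n =>
    (hreg n).indepFun_features_treatments (hfeat n) (hstatic n)
  have homega : ∀ n w k, (D n).omega (P n) w k = ∫ ω, (D n).xbar ω k ∂(P n) := fun n =>
    (hreg n).omega_eq (hmom n) (hstatic n)
  have hlim := Experiment.tendsto_omega hmom hmean homega
  have hG := Experiment.tendsto_whp_inv_smul_gram hreg hmom hind hq hmean hcov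
  have hCLT := Experiment.tendstoInDistribution_sum_ipwWeight_mul_error hreg hmom hq₀ hq₀' hσ hG
  have hremainder := Experiment.tendsto_whp_sqrt_mul_tauHat_sub_gate hreg hmom hind homega hlim
    hq₀ hq₀' hSigma hG
  refine ⟨homega, hlim, tendstoInDistribution_of_tendsto_dist_whp hCLT
    (fun n => (((D n).measurable_tauHat (P n)).sub_const _).const_mul _ |>.aemeasurable) ?_⟩
  simpa only [Real.dist_eq, abs_zero] using hremainder.abs
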